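/- **Theorem 4.1 (Existence of infinite-volume dynamics).** Let $(\Gamma,d)$ be a countable metric space and let $F:[0,\infty)\to(0,\infty)$ be non-increasing with $F(0)=1$, $\|F\|:=\sup_{y\in\Gamma}\sum_{x\in\Gamma}F(d(x,y))<\infty$, and, for some $C_F>0$, $\sum_{z\in\Gamma}F(d(x,z))F(d(z,y))\le C_F\,F(d(x,y))$ for all $x,y\in\Gamma$. Write $r$ for the dimension of the single-site configuration space $\mathbb R^r$. For $k,l\in\Gamma$ let $m_k,\nu_k>0$ and let $V_{kl}:\mathbb R^r\to\mathbb R$ be smooth functions vanishing at infinity such that - $V_{kl}(x)=V_{lk}(-x)$ and $V_{kk}=0$; - there are constants $C_V\ge 0$ and $C_{kl}>0$ with $\|\partial^\beta V_{kl}\|_\infty\le C_{kl}C_V^{|\beta|}$ for all $k,l\in\Gamma$ and all multi-indices $\beta$, and $\sup_{k,l\in\Gamma}C_{kl}/F(d(k,l))<\infty$; - $1/m_k$ and $\nu_k$ are bounded, and bounded away from $0$, uniformly in $k\in\Gamma$. Let $\Omega=\ell_c(\Gamma,\mathbb R^{2r})$ be the space of finitely supported families $\omega=(p_k,q_k)_{k\in\Gamma}$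 in $\mathbb R^r\times\mathbb R^r$, with the inner product of $\ell^2(\Gamma,\mathbb R^{2r})$. For finite $\Lambda\subset\Gamma$ let $\Omega_\Lambda=\{\omega\in\Omega : p_k=q_k=0\text{ for }k\notin\Lambda\}$ and $$H_\Lambda(p,q)=\sum_{k\in\Lambda}\Big(\frac{\|p_k\|^2}{2m_k}+\frac{\nu_k\|q_k\|^2}{2}\Big)+\frac12\sum_{k,l\in\Lambda}V_{kl}(q_k-q_l).$$ For a real inner product space $X$, let $C_{\mathcal R}(X)$, the commutative resolvent algebra, be the C*-subalgebra of $C_b(X)$ generated by the functions $y\mapsto 1/(i\lambda-x\cdot y)$ with $x\in X$, $\lambda\in\mathbb R\setminus\{0\}$. Regard $C_{\mathcal R}(\Omega_\Lambda)$ as a subalgebra of $C_{\mathcal R}(\Omega)$ by composing with the orthogonal projection $\Omega\to\Omega_\Lambda$. Then: 1. For each finite $\Lambda\subset\Gamma$ and each initial point $\omega\in\Omega$, Hamilton's equations $\dot q_k=\partial H_\Lambda/\partial p_k$, $\dot p_k=-\partial H_\Lambda/\partial q_k$ $(k\in\Gamma)$ have exactly one solution $t\mapsto\Phi_t^\Lambda(\omega)\in\Omega$,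 $t\in\mathbb R$ (the sites outside $\Lambda$ do not move). 2. For each finite $\Lambda\subset\Gamma$, $\alpha_t^\Lambda(f):=f\circ\Phi_t^\Lambda$, $t\in\mathbb R$, is a one-parameter group of $*$-automorphisms of $C_{\mathcal R}(\Omega)$ that leaves $C_{\mathcal R}(\Omega_\Lambda)$ invariant. 3. There is a one-parameter group $(\alpha_t)_{t\in\mathbb R}$ of $*$-automorphisms of $C_{\mathcal R}(\Omega)$ (that is, $\alpha_0=\mathrm{id}$ and $\alpha_{s+t}=\alpha_s\circ\alpha_t$ for all $s,t\in\mathbb R$) such that for every $f\in C_{\mathcal R}(\Omega)$ and every $T>0$, $$\lim_{\Lambda\nearrow\Gamma}\ \sup_{|t|\le T}\big\|\alpha_t^\Lambda(f)-\alpha_t(f)\big\|_\infty=0,$$ the limit being taken along the finite subsets of $\Gamma$ ordered by inclusion. -/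

import Mathlib

open Filter Topology BoundedContinuousFunction
open scoped NNReal Gradient InnerProductSpace

noncomputable section

/-! ### The commutative resolvent algebra of a real inner product space -/

namespace ResolventAlgebra

variable {X : Type*} [NormedAddCommGroup X] [InnerProductSpace ℝ X]

theorem abs_le_norm_sub (r c : ℝ) : |r| ≤ ‖Complex.I * (r : ℂ) - (c : ℂ)‖ := by
  have h := Complex.abs_im_le_norm (Complex.I * (r : ℂ) - (c : ℂ))
  simpa using h

theorem sub_ne_zero_of_ne {r : ℝ} (hr : r ≠ 0) (c : ℝ) :
    Complex.I * (r : ℂ) - (c : ℂ) ≠ 0 := by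
  have h := abs_le_norm_sub r c
  have h2 : 0 < |r| := abs_pos.mpr hr
  exact norm_pos_iff.mp (lt_of_lt_of_le h2 h)

/-- The resolvent function `y ↦ 1 / (i r - ⟪x, y⟫)`, for `r ≠ 0`, as a bounded continuous
function on `X`. -/
def resolventFunction (x : X) (r : ℝ) (hr : r ≠ 0) : X →ᵇ ℂ :=
  BoundedContinuousFunction.ofNormedAddCommGroup
    (fun y => 1 / (Complex.I * (r : ℂ) - ((inner ℝ x y : ℝ) : ℂ)))
    (by
      refine Continuous.div continuous_const ?_ (fun y => sub_ne_zero_of_ne hr _)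
      fun_prop)
    (1 / |r|)
    (by
      intro y
      rw [norm_div, norm_one]
      exact one_div_le_one_div_of_le (abs_pos.mpr hr) (abs_le_norm_sub r _))

/-- The C*-subalgebra of `C_b(X)` generated by the resolvent functions with `x` in the subspace
`K`. For finite-dimensional `K` these are exactly the functions `g ∘ π_K`, with `g` in the
commutative resolvent algebra of `K` and `π_K` the orthogonal projection onto `K`.
(The function with `x = 0` is a nonzero constant, so the algebra is automatically unital.) -/
def algebraOn (K : Submodule ℝ X) : StarSubalgebra ℂ (X →ᵇ ℂ) :=
  (StarAlgebra.adjoin ℂ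
    {f : X →ᵇ ℂ | ∃ x ∈ K, ∃ (r : ℝ) (hr : r ≠ 0), f = resolventFunction x r hr}).topologicalClosure

end ResolventAlgebra

/-- The commutative resolvent algebra `C_R(X)`: the C*-subalgebra of `C_b(X)` generated by all
resolvent functions on `X`. -/
def commResolventAlgebra (X : Type*) [NormedAddCommGroup X] [InnerProductSpace ℝ X] :
    StarSubalgebra ℂ (X →ᵇ ℂ) :=
  ResolventAlgebra.algebraOn (⊤ : Submodule ℝ X)

/-! ### The phase space -/

/-- The space `ℝ^{2d} = ℝ^d × ℝ^d` of a single site, with its Euclidean inner product. The first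
component is the momentum and the second one the position. -/
abbrev SitePhaseSpace (d : ℕ) : Type :=
  WithLp 2 (EuclideanSpace ℝ (Fin d) × EuclideanSpace ℝ (Fin d))

/-- The finitely supported elements of `ℓ²(Γ, ℝ^{2d})`. -/
def finitelySupported (Γ : Type*) (d : ℕ) :
    Submodule ℝ (lp (fun _ : Γ => SitePhaseSpace d) 2) where
  carrier := {w | {k : Γ | w k ≠ 0}.Finite}
  add_mem' := by
    intro a b ha hb
    refine (Set.Finite.union ha hb).subset ?_
    intro k hk
    by_contra h
    simp only [Set.mem_union, Set.mem_ofPred_eq, not_or, not_not] at h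
    exact hk (by simp [h.1, h.2])
  zero_mem' := by simp
  smul_mem' := by
    intro c a ha
    refine Set.Finite.subset ha ?_
    intro k hk h
    exact hk (by simp [lp.coeFn_smul, h])

/-- The phase space `Ω = ℓ_c(Γ, ℝ^{2d})`, with the inner product of `ℓ²(Γ, ℝ^{2d})`. -/
abbrev PhaseSpace (Γ : Type*) (d : ℕ) : Type _ := ↥(finitelySupported Γ d)

namespace PhaseSpace

variable {Γ : Type*} {d : ℕ}

/-- The momenta `(p_k)` of a point of the phase space. -/
def p (w : PhaseSpace Γ d) (k : Γ) : EuclideanSpace ℝ (Fin d) :=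
  ((w : lp (fun _ : Γ => SitePhaseSpace d) 2) k).fst

/-- The positions `(q_k)` of a point of the phase space. -/
def q (w : PhaseSpace Γ d) (k : Γ) : EuclideanSpace ℝ (Fin d) :=
  ((w : lp (fun _ : Γ => SitePhaseSpace d) 2) k).snd

/-- The subspace `Ω_Λ` of the points with `p_k = q_k = 0` for `k ∉ Λ`. -/
def localSpace (Λ : Finset Γ) : Submodule ℝ (PhaseSpace Γ d) where
  carrier := {w | ∀ k ∉ Λ, p w k = 0 ∧ q w k = 0}
  add_mem' := by
    intro a b ha hb k hk
    have h1 := ha k hk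
    have h2 := hb k hk
    simp only [p, q] at h1 h2 ⊢
    simp [h1.1, h1.2, h2.1, h2.2]
  zero_mem' := by
    intro k _
    simp [p, q]
  smul_mem' := by
    intro c a ha k hk
    have h1 := ha k hk
    simp only [p, q] at h1 ⊢
    simp [lp.coeFn_smul, h1.1, h1.2]

end PhaseSpace

/-! ### Oscillator systems and their local dynamics -/

/-- The data of a system of interacting oscillators in `ℝ^d` indexed by `Γ`: masses `m`, force
constants `ν` and pair potentials `V`. -/
structure OscillatorSystem (Γ : Type*) (d : ℕ) where
  m : Γ → ℝ
  ν : Γ → ℝ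
  V : Γ → Γ → EuclideanSpace ℝ (Fin d) → ℝ

namespace OscillatorSystem

variable {Γ : Type*} {d : ℕ}

/-- The assumptions on masses, force constants and potentials, where `C k l` and `CV` are the
constants that bound the partial derivatives of the potentials.

A list `σ : Fin n → Fin d` of `n` coordinate directions gives the partial derivative
`∂_{σ 0} ⋯ ∂_{σ (n-1)}`; since the potentials are smooth, these are exactly the derivatives
`∂^β` over the multi-indices `β` of order `n`. -/
structure IsAdmissible (S : OscillatorSystem Γ d) (C : Γ → Γ → ℝ) (CV : ℝ) : Prop where
  symm : ∀ k l x, S.V k l x = S.V l k (-x)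
  diag : ∀ k x, S.V k k x = 0
  smooth : ∀ k l, ContDiff ℝ (⊤ : ℕ∞) (S.V k l)
  vanishing : ∀ k l, Tendsto (S.V k l) (cocompact (EuclideanSpace ℝ (Fin d))) (𝓝 0)
  CV_nonneg : 0 ≤ CV
  C_pos : ∀ k l, 0 < C k l
  deriv_bound : ∀ k l (n : ℕ) (σ : Fin n → Fin d) (x : EuclideanSpace ℝ (Fin d)),
    |iteratedFDeriv ℝ n (S.V k l) x (fun i => EuclideanSpace.single (σ i) (1 : ℝ))|
      ≤ C k l * CV ^ n
  m_pos : ∀ k, 0 < S.m k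
  ν_pos : ∀ k, 0 < S.ν k
  mass_bounds : ∃ a b : ℝ, 0 < a ∧ ∀ k, a ≤ 1 / S.m k ∧ 1 / S.m k ≤ b
  force_bounds : ∃ a b : ℝ, 0 < a ∧ ∀ k, a ≤ S.ν k ∧ S.ν k ≤ b

/-- The local Hamiltonian `H_Λ`, as a function of the momenta `p` and the positions `q`. -/
def hamiltonian (S : OscillatorSystem Γ d) (Λ : Finset Γ)
    (p q : Γ → EuclideanSpace ℝ (Fin d)) : ℝ :=
  ∑ k ∈ Λ, (‖p k‖ ^ 2 / (2 * S.m k) + S.ν k * ‖q k‖ ^ 2 / 2)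
    + 1 / 2 * ∑ k ∈ Λ, ∑ l ∈ Λ, S.V k l (q k - q l)

open Classical in
/-- The partial gradient `∂H_Λ/∂p_k`. -/
def gradP (S : OscillatorSystem Γ d) (Λ : Finset Γ) (p q : Γ → EuclideanSpace ℝ (Fin d)) (k : Γ) :
    EuclideanSpace ℝ (Fin d) :=
  ∇ (fun u => S.hamiltonian Λ (Function.update p k u) q) (p k)

open Classical in
/-- The partial gradient `∂H_Λ/∂q_k`. -/
def gradQ (S : OscillatorSystem Γ d) (Λ : Finset Γ) (p q : Γ → EuclideanSpace ℝ (Fin d)) (k : Γ) :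
    EuclideanSpace ℝ (Fin d) :=
  ∇ (fun u => S.hamiltonian Λ p (Function.update q k u)) (q k)

/-- The curve `γ` in `Ω` is defined for all times and solves Hamilton's equations for `H_Λ`:
`dq_k/dt = ∂H_Λ/∂p_k` and `dp_k/dt = -∂H_Λ/∂q_k` at all sites `k`. (As `H_Λ` depends only on the
sites in `Λ`, the sites outside `Λ` do not move.) -/
def IsTrajectory (S : OscillatorSystem Γ d) (Λ : Finset Γ) (γ : ℝ → PhaseSpace Γ d) : Prop :=
  ∀ (t : ℝ) (k : Γ),
    HasDerivAt (fun s => PhaseSpace.q (γ s) k)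
      (S.gradP Λ (PhaseSpace.p (γ t)) (PhaseSpace.q (γ t)) k) t ∧
    HasDerivAt (fun s => PhaseSpace.p (γ s) k)
      (-S.gradQ Λ (PhaseSpace.p (γ t)) (PhaseSpace.q (γ t)) k) t

open Classical in
/-- The Hamiltonian flow `Φ_t^Λ` of `H_Λ` on `Ω`: the value at time `t` of the trajectory that
starts in `w` (with a dummy value should there be none). On `Ω_Λ` this is the finite-volume flow;
at the sites outside `Λ` it is the identity. -/
def flow (S : OscillatorSystem Γ d) (Λ : Finset Γ) (t : ℝ) (w : PhaseSpace Γ d) : PhaseSpace Γ d :=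
  if h : ∃ γ : ℝ → PhaseSpace Γ d, γ 0 = w ∧ S.IsTrajectory Λ γ then h.choose t else w

end OscillatorSystem

/-- `F : [0, ∞) → (0, ∞)` is non-increasing with `F 0 = 1`, uniformly summable over `Γ`, and has
the convolution property. -/
structure IsDecayFunction (Γ : Type*) [MetricSpace Γ] (F : ℝ≥0 → ℝ) : Prop where
  pos : ∀ r, 0 < F r
  antitone : Antitone F
  map_zero : F 0 = 1
  summable : ∀ y : Γ, Summable fun x : Γ => F (nndist x y)
  bddAbove : BddAbove (Set.range fun y : Γ => ∑' x : Γ, F (nndist x y))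
  convolution : ∃ CF : ℝ, 0 < CF ∧ ∀ x y : Γ,
    Summable (fun z : Γ => F (nndist x z) * F (nndist z y)) ∧
    ∑' z : Γ, F (nndist x z) * F (nndist z y) ≤ CF * F (nndist x y)

end

/-!
# Infinite-volume dynamics on the commutative resolvent algebra

By the Stone-Weierstrass theorem, a bounded continuous function lies in the closed star algebra
generated by a set of functions as soon as it is uniformly continuous for their weak uniformity
(`mem_closure_adjoin_of_tendsto`). Invariance of the resolvent algebra is thus a question about
pairs of nets of initial points, or ultrafilters on pairs, that no resolvent function distinguishes
asymptotically: composing a resolvent function with the flow must not distinguish them either.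

For a finite system, Hamilton's equations are a linear (harmonic) equation perturbed by finitely many
bounded forces `F j (P j x)`, where `P j` extracts the relative position of two sites and `F j`
vanishes at infinity (`PerturbedLinearField`). In the interaction picture the solution is
`exp (t A) (w + displacement w t)` with a bounded displacement, and the linear part merely changes
the vector in a resolvent function. It remains to see that the displacements of two
indistinguishable initial points are asymptotically equal. For every `j`, the curves
`r ↦ P j (exp (r A) w)` range over a finite-dimensional space, so along the ultrafilter either the two
curves approach each other, or both become infinitely large
(`norm_tendsto_atTop_or_tendsto_sub`). As these curves are analytic in time, a large one is large at
all times outside a set of small measure (`exists_forall_measure_norm_le_le`), where the force is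
negligible. In either case the forces along the two linear trajectories, shifted by the same bounded
curve, differ by little in the mean (`tendsto_integral_norm_force_sub`), and Grönwall's inequality
gives the claim (`PerturbedLinearField.tendsto_displacement_sub`). Hence the finite-volume
evolutions preserve the resolvent algebra (`OscillatorSystem.IsAdmissible.evolution_mem`).

For the infinite-volume limit, the trajectories of two nested finite systems are compared by means of
the sum of the deviations at all sites `l`, weighted with `F (d(k, l))`. By the convolution property
of `F` this sum satisfies a Grönwall inequality whose inhomogeneity is the tail of
`∑ l, F (d(k, l))` (`OscillatorSystem.IsAdmissible.exists_norm_sub_le_gronwallBound`). The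
trajectories therefore converge at each site, uniformly in the initial point and on compact time
intervals, and the evolutions are Cauchy on resolvent functions. As they are contractive, they are
Cauchy on the whole algebra, and their limits form a one-parameter group
(`exists_limit_oneParameterGroup`).
-/

/-! ### Star subalgebras of bounded continuous functions -/

namespace BoundedContinuousFunction

/-- Composition with a continuous map, as a star homomorphism between algebras of bounded
continuous functions. -/
noncomputable def pullback {X Y : Type*} [TopologicalSpace X] [TopologicalSpace Y] (φ : C(X, Y)) :
    (Y →ᵇ ℂ) →⋆ₐ[ℂ] (X →ᵇ ℂ) where
  toFun f := f.compContinuous φ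
  map_one' := rfl
  map_mul' _ _ := rfl
  map_zero' := rfl
  map_add' _ _ := rfl
  commutes' _ := rfl
  map_star' _ := rfl

theorem norm_pullback_le {X Y : Type*} [TopologicalSpace X] [TopologicalSpace Y] (φ : C(X, Y))
    (f : Y →ᵇ ℂ) : ‖pullback φ f‖ ≤ ‖f‖ :=
  (norm_le (norm_nonneg f)).2 fun x => f.norm_coe_le_norm (φ x)

theorem continuous_pullback {X Y : Type*} [TopologicalSpace X] [TopologicalSpace Y] (φ : C(X, Y)) :
    Continuous (pullback φ) :=
  AddMonoidHomClass.continuous_of_bound (pullback φ) 1 fun f => by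
    simpa using norm_pullback_le φ f

end BoundedContinuousFunction

theorem StarSubalgebra.closure_adjoin_le {A : Type*} [TopologicalSpace A] [Semiring A] [StarRing A]
    [Algebra ℂ A] [StarModule ℂ A] [IsTopologicalSemiring A] [ContinuousStar A] {s : Set A}
    {B : StarSubalgebra ℂ A} (hs : s ⊆ B) (hB : IsClosed (B : Set A)) :
    (StarAlgebra.adjoin ℂ s).topologicalClosure ≤ B :=
  StarSubalgebra.topologicalClosure_minimal (StarAlgebra.adjoin_le hs) hB

/-- A function that is uniformly continuous for the uniformity induced by `e` extends to the
closure of the range of `e`. -/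
theorem exists_continuous_extension_of_tendsto {X Y : Type*} [UniformSpace Y] (e : X → Y)
    (f : X → ℂ)
    (h : Tendsto (Prod.map f f) (comap (Prod.map e e) (uniformity Y)) (uniformity ℂ)) :
    ∃ g : C(closure (Set.range e), ℂ),
      ∀ x, g ⟨e x, subset_closure (Set.mem_range_self x)⟩ = f x := by
  let _ : UniformSpace X := UniformSpace.comap e inferInstance
  set i : X → closure (Set.range e) := fun x => ⟨e x, subset_closure (Set.mem_range_self x)⟩ with hi
  have hind : IsUniformInducing i := by
    refine IsUniformInducing.of_comp_iff (g := ((↑) : closure (Set.range e) → Y))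
      (isUniformInducing_val _) |>.1 ⟨rfl⟩
  have hdense : DenseRange i := by
    intro y
    rw [closure_subtype]
    have : ((↑) '' Set.range i : Set Y) = Set.range e := by
      rw [← Set.range_comp]; rfl
    rw [this]
    exact y.2
  have hf : UniformContinuous f := h
  have hd : IsDenseInducing i := hind.isDenseInducing hdense
  refine ⟨⟨hd.extend f, (uniformContinuous_uniformly_extend hind hdense hf).continuous⟩, fun x => ?_⟩
  exact uniformly_extend_of_ind hind hdense hf x

/-- **Stone-Weierstrass for a family of functions that need not separate points.** The closed star
subalgebra generated by `s` contains every bounded continuous function that is uniformly continuous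
for the weak uniformity of `s`. -/
theorem mem_closure_adjoin_of_tendsto {X : Type*} [TopologicalSpace X] (s : Set (X →ᵇ ℂ))
    (f : X →ᵇ ℂ)
    (h : Tendsto (fun z : X × X => f z.1 - f z.2)
      (⨅ g ∈ s, comap (fun z : X × X => g z.1 - g z.2) (𝓝 0)) (𝓝 0)) :
    f ∈ (StarAlgebra.adjoin ℂ s).topologicalClosure := by
  -- The values of the generators embed `X`, up to inseparability, into a compact set, on which the
  -- coordinates separate points.
  let e : X → (s → ℂ) := fun x g => g.1 x
  have he : Continuous e := continuous_pi fun g => g.1.continuous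
  have hcomp : IsCompact (closure (Set.range e)) := by
    refine (isCompact_univ_pi fun g : s => isCompact_closedBall (0 : ℂ) ‖g.1‖).closure_of_subset ?_
    rintro _ ⟨x, rfl⟩ g -
    simpa using g.1.norm_coe_le_norm x
  have : CompactSpace (closure (Set.range e)) := isCompact_iff_compactSpace.1 hcomp
  have hf : Tendsto (Prod.map f f) (comap (Prod.map e e) (uniformity (s → ℂ))) (uniformity ℂ) := by
    rw [uniformity_eq_comap_nhds_zero_swapped ℂ, tendsto_comap_iff]
    refine h.mono_left ?_
    rw [Pi.uniformity, comap_iInf]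
    refine le_iInf₂ fun g hg => iInf_le_of_le ⟨g, hg⟩ ?_
    rw [uniformity_eq_comap_nhds_zero_swapped ℂ, comap_comap, comap_comap]
    exact le_rfl
  obtain ⟨F, hF⟩ := exists_continuous_extension_of_tendsto e f hf
  let i : C(X, closure (Set.range e)) :=
    ⟨fun x => ⟨e x, subset_closure (Set.mem_range_self x)⟩, he.subtype_mk _⟩
  let Θ : C(closure (Set.range e), ℂ) →⋆ₐ[ℂ] (X →ᵇ ℂ) :=
    { toFun := fun G => pullback i (mkOfCompact G)
      map_one' := rfl
      map_mul' := fun _ _ => rfl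
      map_zero' := rfl
      map_add' := fun _ _ => rfl
      commutes' := fun _ => rfl
      map_star' := fun _ => rfl }
  have hΘ : Continuous Θ :=
    (continuous_pullback i).comp
      (ContinuousMap.isometryEquivBoundedOfCompact _ ℂ).continuous
  let c : s → C(closure (Set.range e), ℂ) := fun g =>
    ⟨fun y => y.1 g, (continuous_apply g).comp continuous_subtype_val⟩
  have htop := ContinuousMap.starSubalgebra_topologicalClosure_eq_top_of_separatesPoints
    (StarAlgebra.adjoin ℂ (Set.range c)) (by
      intro y z hyz
      have : ∃ g, y.1 g ≠ z.1 g := by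
        by_contra! hcon
        exact hyz (Subtype.ext (funext hcon))
      obtain ⟨g, hg⟩ := this
      exact ⟨_, ⟨c g, StarAlgebra.subset_adjoin ℂ _ ⟨g, rfl⟩, rfl⟩, hg⟩)
  have hle : (StarAlgebra.adjoin ℂ (Set.range c)).topologicalClosure ≤
      ((StarAlgebra.adjoin ℂ s).topologicalClosure).comap Θ := by
    refine StarSubalgebra.closure_adjoin_le ?_ ?_
    · rintro _ ⟨g, rfl⟩
      have : Θ (c g) = g.1 := by ext x; rfl
      change Θ (c g) ∈ (StarAlgebra.adjoin ℂ s).topologicalClosure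
      rw [this]
      exact StarSubalgebra.le_topologicalClosure _ (StarAlgebra.subset_adjoin ℂ _ g.2)
    · exact (StarSubalgebra.isClosed_topologicalClosure _).preimage hΘ
  have hmem : F ∈ ((StarAlgebra.adjoin ℂ s).topologicalClosure).comap Θ :=
    hle (htop ▸ StarSubalgebra.mem_top)
  have hΘF : Θ F = f := by ext x; exact hF x
  rw [← hΘF]
  exact hmem

/-! ### Pairs of nets that resolvents do not distinguish -/

theorem norm_I_sub_ne_zero (u : ℝ) : ‖Complex.I - (u : ℂ)‖ ≠ 0 := by
  have := ResolventAlgebra.abs_le_norm_sub 1 u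
  simp only [abs_one, Complex.ofReal_one, mul_one] at this
  linarith

theorem norm_I_sub_le (u : ℝ) : ‖Complex.I - (u : ℂ)‖ ≤ 1 + |u| := by
  simpa using norm_sub_le Complex.I (u : ℂ)

/-- If two real-valued functions have asymptotically equal resolvents along an ultrafilter, then
either both tend to infinity in absolute value, or they are asymptotically equal. -/
theorem abs_tendsto_atTop_or_tendsto_sub {Z : Type*} {W : Ultrafilter Z} {u v : Z → ℝ}
    (h : Tendsto (fun z => 1 / (Complex.I - (u z : ℂ)) - 1 / (Complex.I - (v z : ℂ))) W (𝓝 0)) :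
    (Tendsto (fun z => |u z|) W atTop ∧ Tendsto (fun z => |v z|) W atTop) ∨
      Tendsto (fun z => u z - v z) W (𝓝 0) := by
  have hI : ∀ x : ℝ, Complex.I - (x : ℂ) ≠ 0 := fun x => norm_ne_zero_iff.1 (norm_I_sub_ne_zero x)
  by_cases hu : Tendsto (fun z => |u z|) W atTop
  · refine Or.inl ⟨hu, ?_⟩
    have h1 : Tendsto (fun z => ‖Complex.I - (u z : ℂ)‖) W atTop := by
      refine tendsto_atTop_mono (fun z => ?_) hu
      simpa using Complex.abs_re_le_norm (Complex.I - (u z : ℂ))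
    have h2 : Tendsto (fun z => 1 / (Complex.I - (u z : ℂ))) W (𝓝 0) := by
      rw [tendsto_zero_iff_norm_tendsto_zero]
      simpa [Pi.inv_def] using h1.inv_tendsto_atTop
    have h3 : Tendsto (fun z => 1 / (Complex.I - (v z : ℂ))) W (𝓝 0) := by
      simpa using h2.sub h
    have h4 : Tendsto (fun z => ‖Complex.I - (v z : ℂ)‖) W atTop := by
      have h5 := (tendsto_zero_iff_norm_tendsto_zero.1 h3)
      have h6 : Tendsto (fun z => ‖1 / (Complex.I - (v z : ℂ))‖) W (𝓝[>] 0) :=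
        tendsto_nhdsWithin_iff.2 ⟨h5, Eventually.of_forall fun z =>
          norm_pos_iff.2 (one_div_ne_zero (hI _))⟩
      refine h6.inv_tendsto_nhdsGT_zero.congr fun z => ?_
      rw [Pi.inv_apply, norm_div, norm_one, one_div, inv_inv]
    refine tendsto_atTop_mono (fun z => ?_) (tendsto_atTop_add_const_right _ (-1) h4)
    linarith [norm_I_sub_le (v z)]
  · right
    -- Along an ultrafilter, `u` is eventually bounded unless it tends to infinity.
    obtain ⟨M, hM⟩ : ∃ M, ∀ᶠ z in (W : Filter Z), |u z| < M := by
      by_contra! hcon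
      have hcon' : ∀ M, ∀ᶠ z in (W : Filter Z), M ≤ |u z| := fun M => by
        simpa using hcon M
      exact hu (tendsto_atTop.2 fun M => hcon' M)
    have hM0 : 0 < 1 + |M| := by positivity
    have hδ := (tendsto_zero_iff_norm_tendsto_zero.1 h).eventually
      (gt_mem_nhds (show (0 : ℝ) < 1 / (2 * (1 + |M|)) by positivity))
    have hlim := (tendsto_zero_iff_norm_tendsto_zero.1 h).mul_const
      ((1 + |M|) * (2 * (1 + |M|)))
    rw [zero_mul] at hlim
    rw [tendsto_zero_iff_norm_tendsto_zero]
    refine squeeze_zero' (Eventually.of_forall fun _ => norm_nonneg _) ?_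
      hlim
    filter_upwards [hM, hδ] with z hz hz'
    have h1 : ‖Complex.I - (u z : ℂ)‖ ≤ 1 + |M| :=
      (norm_I_sub_le _).trans (by linarith [le_abs_self M])
    have h1' : 1 / (1 + |M|) ≤ ‖1 / (Complex.I - (u z : ℂ))‖ := by
      rw [norm_div, norm_one]
      exact one_div_le_one_div_of_le (norm_pos_iff.2 (hI _)) h1
    have h2 : 1 / (2 * (1 + |M|)) ≤ ‖1 / (Complex.I - (v z : ℂ))‖ := by
      have := norm_sub_norm_le (1 / (Complex.I - (u z : ℂ))) (1 / (Complex.I - (v z : ℂ)))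
      have h3 : 1 / (1 + |M|) = 1 / (2 * (1 + |M|)) + 1 / (2 * (1 + |M|)) := by
        field_simp; norm_num
      linarith
    have h4 : ‖Complex.I - (v z : ℂ)‖ ≤ 2 * (1 + |M|) := by
      rw [norm_div, norm_one] at h2
      exact (one_div_le_one_div (by positivity) (norm_pos_iff.2 (hI _))).1 h2
    have h5 : ((u z - v z : ℝ) : ℂ) = (1 / (Complex.I - (u z : ℂ)) - 1 / (Complex.I - (v z : ℂ))) *
        ((Complex.I - (u z : ℂ)) * (Complex.I - (v z : ℂ))) := by
      have e1 := hI (u z)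
      have e2 := hI (v z)
      field_simp
      push_cast
      ring
    rw [← Complex.norm_real, h5, norm_mul, norm_mul]
    gcongr

/-- A linear map of finite rank either tends to infinity along both members of a pair of functions
that linear functionals do not distinguish asymptotically, or it takes asymptotically equal
values. -/
theorem norm_tendsto_atTop_or_tendsto_sub {Z E N : Type*} [AddCommGroup E] [Module ℝ E]
    [NormedAddCommGroup N] [NormedSpace ℝ N] (c : E →ₗ[ℝ] N) [FiniteDimensional ℝ (LinearMap.range c)]
    {W : Ultrafilter Z} {a b : Z → E}
    (h : ∀ l : E →ₗ[ℝ] ℝ, Tendsto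
      (fun z => 1 / (Complex.I - (l (a z) : ℂ)) - 1 / (Complex.I - (l (b z) : ℂ))) W (𝓝 0)) :
    (Tendsto (fun z => ‖c (a z)‖) W atTop ∧ Tendsto (fun z => ‖c (b z)‖) W atTop) ∨
      Tendsto (fun z => c (a z) - c (b z)) W (𝓝 0) := by
  -- Either some coordinate of the image tends to infinity, or all coordinates are close.
  let B := Module.finBasis ℝ (LinearMap.range c)
  let l : Fin (Module.finrank ℝ (LinearMap.range c)) → E →ₗ[ℝ] ℝ :=
    fun i => B.coord i ∘ₗ c.rangeRestrict
  by_cases hi : ∃ i, Tendsto (fun z => |l i (a z)|) W atTop ∧ Tendsto (fun z => |l i (b z)|) W atTop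
  · obtain ⟨i, h1, h2⟩ := hi
    left
    let φ : LinearMap.range c →L[ℝ] ℝ := (B.coord i).toContinuousLinearMap
    have key : ∀ x : Z → E, Tendsto (fun z => |l i (x z)|) W atTop →
        Tendsto (fun z => ‖c (x z)‖) W atTop := by
      intro x hx
      have h3 : ∀ z, |l i (x z)| ≤ (‖φ‖ + 1) * ‖c (x z)‖ := fun z => by
        have := φ.le_opNorm (c.rangeRestrict (x z))
        refine this.trans ?_
        have : ‖c.rangeRestrict (x z)‖ = ‖c (x z)‖ := rfl
        rw [this]
        gcongr
        linarith
      exact (tendsto_const_mul_atTop_of_pos (by positivity)).1 (tendsto_atTop_mono h3 hx)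
    exact ⟨key a h1, key b h2⟩
  · right
    push Not at hi
    have h1 : ∀ i, Tendsto (fun z => l i (a z) - l i (b z)) W (𝓝 0) := fun i => by
      rcases abs_tendsto_atTop_or_tendsto_sub (h (l i)) with h2 | h2
      · exact absurd h2.2 (hi i h2.1)
      · exact h2
    have h2 : ∀ z, c (a z) - c (b z) = ∑ i, (l i (a z) - l i (b z)) • (B i : N) := fun z => by
      have h3 := congrArg (fun x : LinearMap.range c => (x : N))
        (B.sum_repr (c.rangeRestrict (a z - b z)))
      simp only [Submodule.coe_sum, Submodule.coe_smul] at h3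
      rw [← map_sub]
      refine Eq.trans ?_ (h3.symm.trans ?_)
      · rfl
      · refine Finset.sum_congr rfl fun i _ => ?_
        rw [← map_sub]
        rfl
    simp_rw [h2]
    have h3 := tendsto_finsetSum (Finset.univ) fun i (_ : i ∈ Finset.univ) =>
      (h1 i).smul_const (B i : N)
    simpa using h3

/-! ### Time integrals along large curves -/

open MeasureTheory in
/-- In a finite-dimensional space of continuous functions with negligible zero sets, large functions
are large off a small set. -/
theorem exists_forall_measure_norm_le_le {K E G : Type*} [TopologicalSpace K] [CompactSpace K]
    [MeasurableSpace K] [BorelSpace K] {μ : Measure K} [IsFiniteMeasure μ]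
    [AddCommGroup E] [Module ℝ E] [NormedAddCommGroup G] [NormedSpace ℝ G]
    (c : E →ₗ[ℝ] C(K, G)) [FiniteDimensional ℝ (LinearMap.range c)]
    (hnull : ∀ e, c e ≠ 0 → μ {s | c e s = 0} = 0) (R : ℝ) {ε : ℝ} (hε : 0 < ε) :
    ∃ M, ∀ e, M ≤ ‖c e‖ → μ {s | ‖c e s‖ ≤ R} ≤ ENNReal.ofReal ε := by
  have : ProperSpace (LinearMap.range c) := FiniteDimensional.proper ℝ _
  -- A uniform lower bound on the unit sphere, from compactness.
  have hmono : ∀ (u : LinearMap.range c) {δ δ' : ℝ}, δ ≤ δ' →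
      μ {s | ‖(u : C(K, G)) s‖ ≤ δ} ≤ μ {s | ‖(u : C(K, G)) s‖ ≤ δ'} :=
    fun u δ δ' h => measure_mono fun s (hs : _ ≤ δ) => hs.trans h
  have key : ∃ δ > 0, ∀ u ∈ Metric.sphere (0 : LinearMap.range c) 1,
      μ {s | ‖(u : C(K, G)) s‖ ≤ δ} ≤ ENNReal.ofReal ε := by
    refine (isCompact_sphere (0 : LinearMap.range c) 1).induction_on
      (p := fun S => ∃ δ > 0, ∀ u ∈ S, μ {s | ‖(u : C(K, G)) s‖ ≤ δ} ≤ ENNReal.ofReal ε)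
      ⟨1, one_pos, by simp⟩ ?_ ?_ ?_
    · rintro S S' hSS' ⟨δ, hδ, h⟩
      exact ⟨δ, hδ, fun u hu => h u (hSS' hu)⟩
    · rintro S S' ⟨δ, hδ, h⟩ ⟨δ', hδ', h'⟩
      refine ⟨min δ δ', lt_min hδ hδ', ?_⟩
      rintro u (hu | hu)
      · exact (hmono u (min_le_left _ _)).trans (h u hu)
      · exact (hmono u (min_le_right _ _)).trans (h' u hu)
    · intro u hu
      obtain ⟨e, he⟩ := u.2
      have hu0 : c e ≠ 0 := by
        rw [he]
        intro h0
        have : u = 0 := Subtype.ext h0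
        simp [this] at hu
      have h0 : μ {s | (u : C(K, G)) s = 0} = 0 := by rw [← he]; exact hnull e hu0
      have hlim : Tendsto (fun n : ℕ => μ {s | ‖(u : C(K, G)) s‖ ≤ 1 / ((n : ℝ) + 1)}) atTop
          (𝓝 (μ (⋂ n : ℕ, {s | ‖(u : C(K, G)) s‖ ≤ 1 / ((n : ℝ) + 1)}))) := by
        refine tendsto_measure_iInter_atTop (fun n => ?_) ?_ ⟨0, measure_ne_top _ _⟩
        · exact (isClosed_le (by fun_prop) continuous_const).measurableSet.nullMeasurableSet
        · intro n m hnm s hs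
          exact le_trans (Set.mem_ofPred.1 hs) (Nat.one_div_le_one_div hnm)
      have hinter : (⋂ n : ℕ, {s | ‖(u : C(K, G)) s‖ ≤ 1 / ((n : ℝ) + 1)}) ⊆
          {s | (u : C(K, G)) s = 0} := by
        intro s hs
        simp only [Set.mem_iInter] at hs
        have : ‖(u : C(K, G)) s‖ ≤ 0 :=
          ge_of_tendsto' tendsto_one_div_add_atTop_nhds_zero_nat fun n => hs n
        exact norm_le_zero_iff.1 this
      rw [measure_mono_null hinter h0] at hlim
      obtain ⟨n, hn⟩ := (hlim.eventually (gt_mem_nhds (ENNReal.ofReal_pos.2 hε))).exists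
      have hδ : (0 : ℝ) < 1 / ((n : ℝ) + 1) := by positivity
      refine ⟨Metric.ball u (1 / ((n : ℝ) + 1) / 2),
        mem_nhdsWithin_of_mem_nhds (Metric.ball_mem_nhds _ (half_pos hδ)), _, half_pos hδ, ?_⟩
      intro v hv
      refine (measure_mono fun s hs => ?_).trans hn.le
      have h1 : ‖(u : C(K, G)) s - (v : C(K, G)) s‖ < 1 / ((n : ℝ) + 1) / 2 := by
        refine lt_of_le_of_lt ?_ (mem_ball_iff_norm'.1 hv)
        exact ((u - v : LinearMap.range c) : C(K, G)).norm_coe_le_norm s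
      have h2 : ‖(v : C(K, G)) s‖ ≤ 1 / ((n : ℝ) + 1) / 2 := hs
      have h3 := norm_le_norm_add_norm_sub' ((u : C(K, G)) s) ((v : C(K, G)) s)
      change ‖(u : C(K, G)) s‖ ≤ 1 / ((n : ℝ) + 1)
      linarith
  obtain ⟨δ, hδ, h⟩ := key
  refine ⟨|R| / δ + 1, fun e he => ?_⟩
  have hpos : 0 < ‖c e‖ := lt_of_lt_of_le (by positivity) he
  let u : LinearMap.range c := ‖c e‖⁻¹ • ⟨c e, e, rfl⟩
  have hu : u ∈ Metric.sphere (0 : LinearMap.range c) 1 := by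
    rw [mem_sphere_zero_iff_norm, norm_smul, norm_inv, norm_norm]
    exact inv_mul_cancel₀ hpos.ne'
  refine (measure_mono fun s hs => ?_).trans (h u hu)
  have h1 : (u : C(K, G)) s = ‖c e‖⁻¹ • c e s := rfl
  have h2 : ‖c e s‖ ≤ R := hs
  change ‖(u : C(K, G)) s‖ ≤ δ
  rw [h1, norm_smul, norm_inv, norm_norm, inv_mul_le_iff₀ hpos]
  have h3 : |R| ≤ ‖c e‖ * δ := by
    rw [← div_le_iff₀ hδ]
    linarith
  linarith [le_abs_self R]

open MeasureTheory in
/-- The integral of a bounded function that vanishes at infinity, along a bounded perturbation of a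
large member of a finite-dimensional space of curves, is small. -/
theorem exists_forall_integral_norm_comp_le {K E G H : Type*} [TopologicalSpace K] [CompactSpace K]
    [MeasurableSpace K] [BorelSpace K] {μ : Measure K} [IsFiniteMeasure μ]
    [AddCommGroup E] [Module ℝ E] [NormedAddCommGroup G] [NormedSpace ℝ G] [ProperSpace G]
    [NormedAddCommGroup H] (c : E →ₗ[ℝ] C(K, G)) [FiniteDimensional ℝ (LinearMap.range c)]
    (hnull : ∀ e, c e ≠ 0 → μ {s | c e s = 0} = 0)
    {φ : G → H} {B : ℝ} (hB : ∀ u, ‖φ u‖ ≤ B) (hφ : Tendsto φ (cocompact G) (𝓝 0))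
    (C : ℝ) {ε : ℝ} (hε : 0 < ε) :
    ∃ M, ∀ e, M ≤ ‖c e‖ → ∀ κ : K → G, (∀ s, ‖κ s‖ ≤ C) →
      ∫ s, ‖φ (c e s + κ s)‖ ∂μ ≤ ε := by
  have hB0 : 0 ≤ B := (norm_nonneg _).trans (hB 0)
  set m : ℝ := μ.real Set.univ
  have hm : 0 ≤ m := measureReal_nonneg
  set η : ℝ := ε / (2 * (m + 1))
  have hη : 0 < η := by positivity
  obtain ⟨R, hR⟩ : ∃ R, ∀ u, R < ‖u‖ → ‖φ u‖ ≤ η := by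
    have h1 := (tendsto_zero_iff_norm_tendsto_zero.1 hφ).eventually (ge_mem_nhds hη)
    rw [← Metric.cobounded_eq_cocompact, ← comap_norm_atTop, eventually_comap] at h1
    obtain ⟨R, hR⟩ := eventually_atTop.1 h1
    exact ⟨R, fun u hu => hR _ hu.le u rfl⟩
  obtain ⟨M, hM⟩ := exists_forall_measure_norm_le_le c hnull (R + C)
    (show 0 < ε / (2 * (B + 1)) by positivity)
  refine ⟨M, fun e he κ hκ => ?_⟩
  -- Off `S` the argument of `φ` has norm greater than `R`.
  set S : Set K := {s | ‖c e s‖ ≤ R + C}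
  have hS : MeasurableSet S := (isClosed_le (by fun_prop) continuous_const).measurableSet
  have hμS : μ.real S ≤ ε / (2 * (B + 1)) :=
    ENNReal.toReal_le_of_le_ofReal (by positivity) (hM e he)
  have hint : Integrable (fun s => S.indicator (fun _ => B) s + η) μ :=
    ((integrable_const B).indicator hS).add (integrable_const η)
  have hle : ∀ s, ‖φ (c e s + κ s)‖ ≤ S.indicator (fun _ => B) s + η := by
    intro s
    by_cases hs : s ∈ S
    · rw [Set.indicator_of_mem hs]
      linarith [hB (c e s + κ s)]
    · rw [Set.indicator_of_notMem hs, zero_add]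
      apply hR
      have h1 : R + C < ‖c e s‖ := not_le.1 hs
      have h2 := norm_sub_le (c e s + κ s) (κ s)
      rw [add_sub_cancel_right] at h2
      linarith [hκ s]
  refine (integral_mono_of_nonneg (Eventually.of_forall fun _ => norm_nonneg _) hint
    (Eventually.of_forall hle)).trans ?_
  rw [integral_add ((integrable_const B).indicator hS) (integrable_const η),
    integral_indicator_const _ hS, integral_const, smul_eq_mul, smul_eq_mul]
  have h1 : μ.real S * B ≤ ε / 2 := by
    calc μ.real S * B ≤ ε / (2 * (B + 1)) * (B + 1) := by gcongr; linarith
      _ = ε / 2 := by field_simp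
  have h2 : m * η ≤ ε / 2 := by
    calc m * η ≤ (m + 1) * η := by gcongr; linarith
      _ = ε / 2 := by simp only [η]; field_simp
  linarith

/-! ### Grönwall's inequality in integral form -/

theorem le_mul_exp_of_le_integral {u : ℝ → ℝ} {δ K T : ℝ} (hT : 0 ≤ T) (hK : 0 ≤ K)
    (hu : Continuous u) (h : ∀ t ∈ Set.Icc 0 T, u t ≤ δ + K * ∫ s in (0 : ℝ)..t, u s) :
    u T ≤ δ * Real.exp (K * T) := by
  set g : ℝ → ℝ := fun t => δ + K * ∫ s in (0 : ℝ)..t, u s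
  have hg : ∀ t, HasDerivAt g (K * u t) t := fun t =>
    ((hu.integral_hasStrictDerivAt 0 t).hasDerivAt.const_mul K).const_add δ
  have hle := le_gronwallBound_of_liminf_deriv_right_le (f := g) (f' := fun t => K * u t) (δ := δ)
    (K := K) (ε := 0) (a := 0) (b := T)
    (fun t _ => (hg t).continuousAt.continuousWithinAt)
    (fun t _ r hr => ((hg t).hasDerivWithinAt (s := Set.Ici t)).liminf_right_slope_le hr) (by simp [g])
    (fun t ht => by
      simpa using mul_le_mul_of_nonneg_left (h t (Set.Ico_subset_Icc_self ht)) hK) T ⟨hT, le_rfl⟩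
  rw [gronwallBound_ε0, sub_zero] at hle
  exact (h T ⟨hT, le_rfl⟩).trans hle

/-! ### Bounded perturbations of linear flows -/

/-- A time-dependent vector field that is bounded and Lipschitz, uniformly on compact time
intervals, has global integral curves. -/
theorem exists_global_solution_of_bounded {E : Type*} [NormedAddCommGroup E] [NormedSpace ℝ E]
    [CompleteSpace E] {f : ℝ → E → E}
    (hlip : ∀ T : ℝ, ∃ K : ℝ≥0, ∀ t ∈ Set.Icc (-T) T, LipschitzWith K (f t))
    (hbdd : ∀ T : ℝ, ∃ L : ℝ≥0, ∀ t ∈ Set.Icc (-T) T, ∀ x, ‖f t x‖ ≤ L)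
    (hcont : ∀ x, Continuous fun t => f t x) (x₀ : E) :
    ∃ α : ℝ → E, α 0 = x₀ ∧ ∀ t, HasDerivAt α (f t (α t)) t := by
  have hloc : ∀ n : ℕ, ∃ α : ℝ → E, α 0 = x₀ ∧
      ∀ t ∈ Set.Ioo (-(n + 1 : ℝ)) (n + 1), HasDerivAt α (f t (α t)) t := by
    intro n
    obtain ⟨K, hK⟩ := hlip (n + 1)
    obtain ⟨L, hL⟩ := hbdd (n + 1)
    have h0 : (0 : ℝ) ∈ Set.Icc (-(n + 1 : ℝ)) (n + 1) := ⟨by linarith, by positivity⟩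
    have hPL : IsPicardLindelof f (⟨0, h0⟩ : Set.Icc (-(n + 1 : ℝ)) (n + 1)) x₀
        (L * (n + 1)) 0 L K :=
      { lipschitzOnWith := fun t ht => (hK t ht).lipschitzOnWith
        continuousOn := fun x _ => (hcont x).continuousOn
        norm_le := fun t ht x _ => hL t ht x
        mul_max_le := by simp }
    obtain ⟨α, hα0, hα⟩ := hPL.exists_eq_forall_mem_Icc_hasDerivWithinAt₀
    exact ⟨α, hα0, fun t ht => (hα t (Set.Ioo_subset_Icc_self ht)).hasDerivAt (Icc_mem_nhds ht.1 ht.2)⟩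
  choose α hα0 hα using hloc
  have hagree : ∀ n m : ℕ, n ≤ m → Set.EqOn (α n) (α m) (Set.Ioo (-(n + 1 : ℝ)) (n + 1)) := by
    intro n m hnm
    obtain ⟨K, hK⟩ := hlip (n + 1)
    have hnm' : (n : ℝ) ≤ m := by exact_mod_cast hnm
    refine ODE_solution_unique_of_mem_Ioo (v := f) (s := fun _ => Set.univ) (K := K) (t₀ := 0)
      (fun t ht => (hK t (Set.Ioo_subset_Icc_self ht)).lipschitzOnWith)
      ⟨by linarith, by positivity⟩ (fun t ht => ⟨hα n t ht, trivial⟩)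
      (fun t ht => ⟨hα m t ⟨by linarith [ht.1], by linarith [ht.2]⟩, trivial⟩)
      ((hα0 n).trans (hα0 m).symm)
  -- Glue the solutions on the intervals `(-(n + 1), n + 1)`.
  let β : ℝ → E := fun t => α ⌈|t|⌉₊ t
  have hβ : ∀ (n : ℕ), ∀ t ∈ Set.Ioo (-(n : ℝ)) n, β t = α n t := by
    intro n t ht
    have h1 : |t| < n := abs_lt.2 ht
    have h2 : ⌈|t|⌉₊ ≤ n := Nat.ceil_le.2 h1.le
    have h3 : |t| ≤ ⌈|t|⌉₊ := Nat.le_ceil _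
    exact hagree _ _ h2 (abs_lt.1 (by linarith))
  refine ⟨β, by simpa [β] using hα0 0, fun t => ?_⟩
  set n : ℕ := ⌈|t|⌉₊ + 1 with hn
  have ht : t ∈ Set.Ioo (-(n : ℝ)) n := by
    rw [Set.mem_Ioo, ← abs_lt, hn]
    have := Nat.le_ceil |t|
    push_cast
    linarith
  have hev : β =ᶠ[𝓝 t] α n := by
    filter_upwards [Ioo_mem_nhds ht.1 ht.2] with s hs using hβ n s hs
  have := hα n t ⟨by linarith [ht.1], by linarith [ht.2]⟩
  rw [← hβ n t ht] at this
  exact this.congr_of_eventuallyEq hev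

/-- The vector field `x ↦ A x + ∑ j, F j (P j x)` on `E`, where `A` and the `P j` are linear and the
`F j` are bounded Lipschitz functions that vanish at infinity. The perturbation is bounded, but it
need not vanish at infinity, as the `P j` may have kernels. -/
structure PerturbedLinearField (E G J : Type*) [NormedAddCommGroup E] [NormedSpace ℝ E]
    [NormedAddCommGroup G] [NormedSpace ℝ G] where
  A : E →L[ℝ] E
  P : J → E →L[ℝ] G
  F : J → G → E
  lip : ℝ≥0
  bound : ℝ≥0
  lipschitz : ∀ j, LipschitzWith lip (F j)
  norm_le : ∀ j u, ‖F j u‖ ≤ bound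
  vanishing : ∀ j, Tendsto (F j) (cocompact G) (𝓝 0)

namespace PerturbedLinearField

variable {E G J : Type*} [NormedAddCommGroup E] [NormedSpace ℝ E] [NormedAddCommGroup G]
  [NormedSpace ℝ G] (S : PerturbedLinearField E G J)

/-- The vector field with the opposite sign, which generates the reversed flow. -/
def reverse (S : PerturbedLinearField E G J) : PerturbedLinearField E G J where
  A := -S.A
  P := S.P
  F j u := -S.F j u
  lip := S.lip
  bound := S.bound
  lipschitz j := (S.lipschitz j).neg
  norm_le j u := by simpa using S.norm_le j u
  vanishing j := by simpa using (S.vanishing j).neg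

/-- The linear flow `exp (t A)`. -/
noncomputable def linearFlow (S : PerturbedLinearField E G J) (t : ℝ) : E →L[ℝ] E :=
  NormedSpace.exp (t • S.A)

theorem linearFlow_zero : S.linearFlow 0 = 1 := by
  simp [linearFlow]

theorem reverse_linearFlow (t : ℝ) : S.reverse.linearFlow t = S.linearFlow (-t) := by
  simp [linearFlow, reverse]

section Complete

variable [CompleteSpace E]

theorem hasDerivAt_linearFlow (t : ℝ) :
    HasDerivAt S.linearFlow (S.A * S.linearFlow t) t :=
  hasDerivAt_exp_smul_const' (𝕂 := ℝ) S.A t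

theorem hasDerivAt_linearFlow' (t : ℝ) :
    HasDerivAt S.linearFlow (S.linearFlow t * S.A) t :=
  hasDerivAt_exp_smul_const (𝕂 := ℝ) S.A t

theorem continuous_linearFlow : Continuous S.linearFlow :=
  continuous_iff_continuousAt.2 fun t => (S.hasDerivAt_linearFlow t).continuousAt

theorem linearFlow_mul_neg (t : ℝ) : S.linearFlow t * S.linearFlow (-t) = 1 := by
  have h : Commute (t • S.A) ((-t) • S.A) :=
    ((Commute.refl S.A).smul_left t).smul_right (-t)
  let _ : NormedAlgebra ℚ (E →L[ℝ] E) := NormedAlgebra.restrictScalars ℚ ℝ _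
  rw [linearFlow, linearFlow, ← NormedSpace.exp_add_of_commute h]
  simp

theorem linearFlow_apply_neg (t : ℝ) (x : E) : S.linearFlow t (S.linearFlow (-t) x) = x := by
  simpa using congrArg (fun L : E →L[ℝ] E => L x) (S.linearFlow_mul_neg t)

theorem analyticOnNhd_linearFlow : AnalyticOnNhd ℝ S.linearFlow Set.univ := fun t _ =>
  (NormedSpace.exp_analytic (𝕂 := ℝ) (t • S.A)).comp_of_eq
    ((analyticAt_id).smul analyticAt_const) rfl

theorem exists_norm_linearFlow_le (T : ℝ) :
    ∃ u : ℝ≥0, ∀ t ∈ Set.Icc (-T) T, ‖S.linearFlow t‖ ≤ u := by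
  obtain ⟨u, hu⟩ := isCompact_Icc.exists_bound_of_continuousOn
    (S.continuous_linearFlow.continuousOn (s := Set.Icc (-T) T))
  exact ⟨u.toNNReal, fun t ht => (hu t ht).trans (Real.le_coe_toNNReal u)⟩

/-- The curve `r ↦ P j (exp (r A) e)` on `[0, T]`. -/
noncomputable def probe (T : ℝ) (j : J) : E →ₗ[ℝ] C(Set.Icc 0 T, G) where
  toFun e := ⟨fun r => S.P j (S.linearFlow r e),
    (S.P j).continuous.comp
      ((S.continuous_linearFlow.comp continuous_subtype_val).clm_apply continuous_const)⟩
  map_add' e e' := by ext r; simp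
  map_smul' a e := by ext r; simp

theorem probe_apply (T : ℝ) (j : J) (e : E) (r : Set.Icc 0 T) :
    S.probe T j e r = S.P j (S.linearFlow r e) := rfl

open MeasureTheory in
/-- As the linear flow is analytic in time, probes vanish identically or almost nowhere. -/
theorem volume_probe_eq_zero (T : ℝ) (j : J) (e : E) (he : S.probe T j e ≠ 0) :
    (volume.comap ((↑) : Set.Icc 0 T → ℝ)) {r | S.probe T j e r = 0} = 0 := by
  let g : ℝ → G := fun r => S.P j (S.linearFlow r e)
  have hg : AnalyticOnNhd ℝ g Set.univ := fun r _ => by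
    have h1 : AnalyticAt ℝ (fun r => S.linearFlow r e) r :=
      ((ContinuousLinearMap.apply ℝ E e).analyticAt _).comp (S.analyticOnNhd_linearFlow r trivial)
    exact ((S.P j).analyticAt _).comp h1
  rcases hg.eqOn_zero_or_eventually_ne_zero_of_preconnected isPreconnected_univ with h | h
  · exact absurd (ContinuousMap.ext fun r : Set.Icc 0 T => h (Set.mem_univ (r : ℝ))) he
  · have h1 : ∀ᵐ r ∂(volume : Measure ℝ), g r ≠ 0 := by
      have := ae_restrict_le_codiscreteWithin (μ := volume) MeasurableSet.univ h
      rwa [Measure.restrict_univ] at this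
    have h2 : volume {r | g r = 0} = 0 := by simpa [ae_iff] using h1
    have h3 := (MeasurableEmbedding.subtype_coe (measurableSet_Icc (a := (0 : ℝ)) (b := T))).comap_apply
      volume {r : Set.Icc 0 T | S.probe T j e r = 0}
    rw [h3]
    refine measure_mono_null ?_ h2
    rintro _ ⟨r, hr, rfl⟩
    exact hr

open MeasureTheory in
theorem integral_eq_integral_Icc {T : ℝ} (hT : 0 ≤ T) (f : ℝ → ℝ) :
    ∫ s in (0 : ℝ)..T, f s = ∫ s : Set.Icc 0 T, f s ∂(volume.comap ((↑) : Set.Icc 0 T → ℝ)) := by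
  rw [intervalIntegral.integral_of_le hT, ← integral_Icc_eq_integral_Ioc,
    integral_subtype_comap measurableSet_Icc]

open MeasureTheory in
/-- Bounded perturbations of the two linear trajectories are subject to asymptotically the same
forces: either the forces vanish in the limit or the trajectories approach each other. -/
theorem tendsto_integral_norm_force_sub [FiniteDimensional ℝ E] [ProperSpace G] {T : ℝ}
    (hT : 0 ≤ T) (j : J) {Z : Type*} {W : Ultrafilter Z} {a b : Z → E}
    (h : ∀ l : E →ₗ[ℝ] ℝ, Tendsto
      (fun z => 1 / (Complex.I - (l (a z) : ℂ)) - 1 / (Complex.I - (l (b z) : ℂ))) W (𝓝 0))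
    {κ : Z → ℝ → G} {C : ℝ} (hκ : ∀ z, Continuous (κ z)) (hC : ∀ z, ∀ s ∈ Set.Icc 0 T, ‖κ z s‖ ≤ C) :
    Tendsto (fun z => ∫ s in (0 : ℝ)..T, ‖S.F j (S.P j (S.linearFlow s (a z)) + κ z s) -
      S.F j (S.P j (S.linearFlow s (b z)) + κ z s)‖) W (𝓝 0) := by
  have hlin : ∀ e, Continuous fun s => S.P j (S.linearFlow s e) := fun e =>
    (S.P j).continuous.comp (S.continuous_linearFlow.clm_apply continuous_const)
  have hF : ∀ (x : Z → E) (z : Z), Continuous fun s => S.F j (S.P j (S.linearFlow s (x z)) + κ z s) :=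
    fun x z => (S.lipschitz j).continuous.comp ((hlin _).add (hκ z))
  have hnn : ∀ z, 0 ≤ ∫ s in (0 : ℝ)..T, ‖S.F j (S.P j (S.linearFlow s (a z)) + κ z s) -
      S.F j (S.P j (S.linearFlow s (b z)) + κ z s)‖ := fun z =>
    intervalIntegral.integral_nonneg hT fun _ _ => norm_nonneg _
  rcases norm_tendsto_atTop_or_tendsto_sub (S.probe T j) h with ⟨ha, hb⟩ | hab
  · have : IsFiniteMeasure (volume.comap ((↑) : Set.Icc 0 T → ℝ)) := by
      refine ⟨?_⟩
      rw [(MeasurableEmbedding.subtype_coe (measurableSet_Icc (a := (0 : ℝ)) (b := T))).comap_apply,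
        Set.image_univ, Subtype.range_coe]
      exact measure_Icc_lt_top
    rw [Metric.tendsto_nhds]
    intro ε hε
    obtain ⟨M, hM⟩ := exists_forall_integral_norm_comp_le (S.probe T j)
      (S.volume_probe_eq_zero T j) (S.norm_le j) (S.vanishing j) C (show 0 < ε / 3 by positivity)
    filter_upwards [ha.eventually_ge_atTop M, hb.eventually_ge_atTop M] with z hza hzb
    rw [Real.dist_eq, sub_zero, abs_of_nonneg (hnn z)]
    have h1 := hM _ hza (fun s => κ z s) fun s => hC z s s.2
    have h2 := hM _ hzb (fun s => κ z s) fun s => hC z s s.2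
    simp only [probe_apply] at h1 h2
    rw [← integral_eq_integral_Icc hT
      (fun s => ‖S.F j (S.P j (S.linearFlow s (a z)) + κ z s)‖)] at h1
    rw [← integral_eq_integral_Icc hT
      (fun s => ‖S.F j (S.P j (S.linearFlow s (b z)) + κ z s)‖)] at h2
    have i1 := (hF a z).norm.intervalIntegrable (μ := volume) 0 T
    have i2 := (hF b z).norm.intervalIntegrable (μ := volume) 0 T
    have h3 := intervalIntegral.integral_mono_on hT
      (((hF a z).sub (hF b z)).norm.intervalIntegrable 0 T) (i1.add i2)
      fun s _ => norm_sub_le _ _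
    rw [intervalIntegral.integral_add i1 i2] at h3
    simp only [Pi.sub_apply] at h3
    linarith
  · have hlim := (tendsto_zero_iff_norm_tendsto_zero.1 hab).const_mul (S.lip * T)
    rw [mul_zero] at hlim
    refine squeeze_zero hnn (fun z => ?_) hlim
    have h1 := intervalIntegral.integral_mono_on hT
      (((hF a z).sub (hF b z)).norm.intervalIntegrable (μ := volume) 0 T)
      (intervalIntegrable_const (c := S.lip * ‖S.probe T j (a z) - S.probe T j (b z)‖))
      fun s hs => by
        refine ((S.lipschitz j).norm_sub_le _ _).trans ?_
        rw [add_sub_add_right_eq_sub]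
        gcongr
        exact (S.probe T j (a z) - S.probe T j (b z)).norm_coe_le_norm ⟨s, hs⟩
    refine h1.trans (le_of_eq ?_)
    rw [intervalIntegral.integral_const, smul_eq_mul]
    ring

end Complete

variable [Fintype J]

/-- The nonlinear part of the vector field. -/
def perturbation (x : E) : E := ∑ j, S.F j (S.P j x)

/-- The vector field. -/
def field (x : E) : E := S.A x + S.perturbation x

theorem reverse_field (x : E) : S.reverse.field x = -S.field x := by
  simp [field, perturbation, reverse, add_comm]

theorem exists_lipschitzWith_perturbation : ∃ K, LipschitzWith K S.perturbation := by
  refine ⟨∑ j, S.lip * ‖S.P j‖₊, ?_⟩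
  unfold perturbation
  have : ∀ s : Finset J, LipschitzWith (∑ j ∈ s, S.lip * ‖S.P j‖₊)
      fun x => ∑ j ∈ s, S.F j (S.P j x) := by
    classical
    intro s
    induction s using Finset.induction_on with
    | empty => simp [LipschitzWith.const (0 : E)]
    | insert j s hj ih =>
      simp only [Finset.sum_insert hj]
      exact ((S.lipschitz j).comp (S.P j).lipschitz).add ih
  exact this Finset.univ

theorem exists_lipschitzWith_field : ∃ K, LipschitzWith K S.field := by
  obtain ⟨K, hK⟩ := S.exists_lipschitzWith_perturbation
  exact ⟨_, S.A.lipschitz.add hK⟩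

theorem norm_perturbation_le (x : E) : ‖S.perturbation x‖ ≤ Fintype.card J * S.bound := by
  refine (norm_sum_le _ _).trans ?_
  simpa using Finset.sum_le_sum fun j (_ : j ∈ Finset.univ) => S.norm_le j (S.P j x)

variable [CompleteSpace E]

theorem exists_solution (w : E) :
    ∃ γ : ℝ → E, γ 0 = w ∧ ∀ t, HasDerivAt γ (S.field (γ t)) t := by
  -- In the interaction picture `y = exp (-t A) x` the vector field is bounded.
  obtain ⟨K, hK⟩ := S.exists_lipschitzWith_perturbation
  obtain ⟨y, hy0, hy⟩ := exists_global_solution_of_bounded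
    (f := fun t y => S.linearFlow (-t) (S.perturbation (S.linearFlow t y)))
    (by
      intro T
      obtain ⟨u, hu⟩ := S.exists_norm_linearFlow_le T
      refine ⟨u * (K * u), fun t ht => ?_⟩
      have h1 := (S.linearFlow t).lipschitz.weaken (K' := u) (hu t ht)
      have h2 := (S.linearFlow (-t)).lipschitz.weaken (K' := u)
        (hu (-t) ⟨by linarith [ht.2], by linarith [ht.1]⟩)
      exact h2.comp (hK.comp h1))
    (by
      intro T
      obtain ⟨u, hu⟩ := S.exists_norm_linearFlow_le T
      refine ⟨u * (Fintype.card J * S.bound), fun t ht x => ?_⟩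
      refine ((S.linearFlow (-t)).le_opNorm _).trans ?_
      push_cast
      exact mul_le_mul (hu (-t) ⟨by linarith [ht.2], by linarith [ht.1]⟩)
        (S.norm_perturbation_le _) (norm_nonneg _) u.2)
    (by
      intro x
      exact (S.continuous_linearFlow.comp continuous_neg).clm_apply
        (hK.continuous.comp (S.continuous_linearFlow.clm_apply continuous_const))) w
  refine ⟨fun t => S.linearFlow t (y t), by simp [linearFlow_zero, hy0], fun t => ?_⟩
  have h := (S.hasDerivAt_linearFlow t).clm_apply (hy t)
  rw [S.linearFlow_apply_neg] at h
  exact h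

/-- The integral curve that starts in `w`. -/
noncomputable def sol (w : E) : ℝ → E := (S.exists_solution w).choose

theorem sol_zero (w : E) : S.sol w 0 = w := (S.exists_solution w).choose_spec.1

theorem hasDerivAt_sol (w : E) (t : ℝ) : HasDerivAt (S.sol w) (S.field (S.sol w t)) t :=
  (S.exists_solution w).choose_spec.2 t

theorem eq_sol {γ : ℝ → E} (h : ∀ t, HasDerivAt γ (S.field (γ t)) t) : γ = S.sol (γ 0) := by
  obtain ⟨K, hK⟩ := S.exists_lipschitzWith_field
  exact ODE_solution_unique_univ (v := fun _ => S.field) (s := fun _ => Set.univ) (K := K) (t₀ := 0)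
    (fun _ => hK.lipschitzOnWith) (fun t => ⟨h t, trivial⟩)
    (fun t => ⟨S.hasDerivAt_sol _ t, trivial⟩) (S.sol_zero _).symm

theorem sol_add (w : E) (s t : ℝ) : S.sol w (s + t) = S.sol (S.sol w t) s := by
  have h := S.eq_sol (γ := fun s => S.sol w (s + t)) fun s =>
    (S.hasDerivAt_sol w (s + t)).comp_add_const s t
  simpa using congrFun h s

theorem reverse_sol (w : E) (t : ℝ) : S.reverse.sol w t = S.sol w (-t) := by
  have h := S.reverse.eq_sol (γ := fun s => S.sol w (-s)) fun s => by
    rw [reverse_field]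
    simpa [Function.comp_def] using (S.hasDerivAt_sol w (-s)).scomp s (hasDerivAt_neg s)
  have := congrFun h t
  simp only [neg_zero, sol_zero] at this
  exact this.symm

theorem continuous_sol_apply (t : ℝ) : Continuous fun w => S.sol w t := by
  have key : ∀ (S : PerturbedLinearField E G J) (t : ℝ), 0 ≤ t → Continuous fun w => S.sol w t := by
    intro S t ht
    obtain ⟨K, hK⟩ := S.exists_lipschitzWith_field
    have hc : ∀ w, Continuous (S.sol w) := fun w =>
      continuous_iff_continuousAt.2 fun t => (S.hasDerivAt_sol w t).continuousAt
    refine (LipschitzWith.of_dist_le_mul (K := (Real.exp (K * t)).toNNReal)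
      fun w w' => ?_).continuous
    have := dist_le_of_trajectories_ODE (v := fun _ => S.field) (fun _ => hK) (a := 0) (b := t)
      (hc w).continuousOn (fun s _ => (S.hasDerivAt_sol w s).hasDerivWithinAt)
      (hc w').continuousOn (fun s _ => (S.hasDerivAt_sol w' s).hasDerivWithinAt) le_rfl t ⟨ht, le_rfl⟩
    rw [S.sol_zero, S.sol_zero, sub_zero, mul_comm] at this
    rwa [Real.coe_toNNReal _ (Real.exp_nonneg _)]
  rcases le_total 0 t with ht | ht
  · exact key S t ht
  · have := key S.reverse (-t) (by linarith)
    simpa only [reverse_sol, neg_neg] using this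

/-- The displacement `exp (-t A) x(t) - x(0)` in the interaction picture. -/
noncomputable def displacement (w : E) (t : ℝ) : E := S.linearFlow (-t) (S.sol w t) - w

theorem sol_eq (w : E) (t : ℝ) :
    S.sol w t = S.linearFlow t w + S.linearFlow t (S.displacement w t) := by
  rw [displacement, map_sub, S.linearFlow_apply_neg]
  abel

theorem reverse_displacement (w : E) (t : ℝ) :
    S.reverse.displacement w t = S.displacement w (-t) := by
  simp only [displacement, reverse_linearFlow, reverse_sol]

theorem displacement_zero (w : E) : S.displacement w 0 = 0 := by
  simp [displacement, linearFlow_zero, sol_zero]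

theorem hasDerivAt_displacement (w : E) (t : ℝ) :
    HasDerivAt (S.displacement w) (S.linearFlow (-t) (S.perturbation (S.sol w t))) t := by
  have h1 : HasDerivAt (fun t => S.linearFlow (-t)) (-(S.linearFlow (-t) * S.A)) t := by
    simpa [Function.comp_def] using (S.hasDerivAt_linearFlow' (-t)).scomp t (hasDerivAt_neg t)
  have h2 := (h1.clm_apply (S.hasDerivAt_sol w t)).sub_const w
  refine h2.congr_deriv ?_
  simp [field]

theorem continuous_displacement (w : E) : Continuous (S.displacement w) :=
  continuous_iff_continuousAt.2 fun t => (S.hasDerivAt_displacement w t).continuousAt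

theorem exists_norm_displacement_le {T : ℝ} (hT : 0 ≤ T) :
    ∃ C, ∀ w, ∀ t ∈ Set.Icc 0 T, ‖S.displacement w t‖ ≤ C := by
  obtain ⟨u, hu⟩ := S.exists_norm_linearFlow_le T
  refine ⟨u * (Fintype.card J * S.bound) * T, fun w t ht => ?_⟩
  have h := norm_image_sub_le_of_norm_deriv_le_segment' (f := S.displacement w) (a := 0) (b := T)
    (C := u * (Fintype.card J * S.bound))
    (fun s _ => (S.hasDerivAt_displacement w s).hasDerivWithinAt)
    (fun s hs => ((S.linearFlow (-s)).le_opNorm _).trans (mul_le_mul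
      (hu (-s) ⟨by linarith [hs.2], by linarith [hs.1]⟩)
        (S.norm_perturbation_le _) (norm_nonneg _) u.2)) t ht
  rw [displacement_zero, sub_zero, sub_zero] at h
  exact h.trans (by gcongr; exact ht.2)

/-- Initial points that linear functionals do not distinguish asymptotically have asymptotically
equal displacements. -/
theorem tendsto_displacement_sub_of_nonneg [FiniteDimensional ℝ E] [ProperSpace G] {T : ℝ}
    (hT : 0 ≤ T) {Z : Type*} {W : Ultrafilter Z} {a b : Z → E}
    (h : ∀ l : E →ₗ[ℝ] ℝ, Tendsto
      (fun z => 1 / (Complex.I - (l (a z) : ℂ)) - 1 / (Complex.I - (l (b z) : ℂ))) W (𝓝 0)) :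
    Tendsto (fun z => S.displacement (a z) T - S.displacement (b z) T) W (𝓝 0) := by
  obtain ⟨u, hu⟩ := S.exists_norm_linearFlow_le T
  obtain ⟨C, hC⟩ := S.exists_norm_displacement_le hT
  have hu' : ∀ s ∈ Set.Icc 0 T, ‖S.linearFlow s‖ ≤ u := fun s hs =>
    hu s ⟨by linarith [hs.1], hs.2⟩
  have hsol : ∀ w, Continuous (S.sol w) := fun w =>
    continuous_iff_continuousAt.2 fun t => (S.hasDerivAt_sol w t).continuousAt
  obtain ⟨L, hL⟩ := S.exists_lipschitzWith_perturbation
  -- The forces along `a` are compared with those along the trajectory that starts in `a` and has the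
  -- displacement of `b`; `η` is their distance to the forces along `b`.
  let κ : J → Z → ℝ → G := fun j z s => S.P j (S.linearFlow s (S.displacement (b z) s))
  have hκ : ∀ j z, Continuous (κ j z) := fun j z =>
    (S.P j).continuous.comp (S.continuous_linearFlow.clm_apply (S.continuous_displacement _))
  let η : J → Z → ℝ → ℝ := fun j z s => ‖S.F j (S.P j (S.linearFlow s (a z)) + κ j z s) -
      S.F j (S.P j (S.linearFlow s (b z)) + κ j z s)‖
  have hη : ∀ j z, Continuous (η j z) := fun j z =>
    (((S.lipschitz j).continuous.comp (((S.P j).continuous.comp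
      (S.continuous_linearFlow.clm_apply continuous_const)).add (hκ j z))).sub
    ((S.lipschitz j).continuous.comp (((S.P j).continuous.comp
      (S.continuous_linearFlow.clm_apply continuous_const)).add (hκ j z)))).norm
  have hη0 : ∀ j z s, 0 ≤ η j z s := fun _ _ _ => norm_nonneg _
  have hI : ∀ j, Tendsto (fun z => ∫ s in (0 : ℝ)..T, η j z s) W (𝓝 0) := fun j =>
    S.tendsto_integral_norm_force_sub hT j h (C := ‖S.P j‖ * (u * C)) (hκ j) fun z s hs =>
      ((S.P j).le_opNorm _).trans (by
        gcongr
        refine ((S.linearFlow s).le_opNorm _).trans ?_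
        exact mul_le_mul (hu' s hs) (hC _ s hs) (norm_nonneg _) u.2)
  have hδ : Tendsto (fun z => u * ∑ j, ∫ s in (0 : ℝ)..T, η j z s) W (𝓝 0) := by
    have := (tendsto_finsetSum (Finset.univ) fun j (_ : j ∈ Finset.univ) => hI j).const_mul (u : ℝ)
    simpa using this
  set K : ℝ := u * (∑ j, S.lip * ‖S.P j‖ * u)
  have hK : 0 ≤ K := by positivity
  let D : Z → ℝ → E := fun z s => S.displacement (a z) s - S.displacement (b z) s
  let D' : Z → ℝ → E := fun z s => S.linearFlow (-s)
    (S.perturbation (S.sol (a z) s) - S.perturbation (S.sol (b z) s))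
  have hD : ∀ z s, HasDerivAt (D z) (D' z s) s := fun z s => by
    have := (S.hasDerivAt_displacement (a z) s).sub (S.hasDerivAt_displacement (b z) s)
    rwa [← map_sub] at this
  have hDc : ∀ z, Continuous (D z) := fun z =>
    continuous_iff_continuousAt.2 fun t => (hD z t).continuousAt
  have hD'c : ∀ z, Continuous (D' z) := fun z =>
    (S.continuous_linearFlow.comp continuous_neg).clm_apply
      ((hL.continuous.comp (hsol _)).sub (hL.continuous.comp (hsol _)))
  have hbound : ∀ z, ∀ s ∈ Set.Icc 0 T, ‖D' z s‖ ≤ K * ‖D z s‖ + u * ∑ j, η j z s := by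
    intro z s hs
    have h1 : ∀ j, ‖S.F j (S.P j (S.sol (a z) s)) - S.F j (S.P j (S.sol (b z) s))‖ ≤
        S.lip * ‖S.P j‖ * u * ‖D z s‖ + η j z s := by
      intro j
      have e1 : S.P j (S.sol (b z) s) = S.P j (S.linearFlow s (b z)) + κ j z s := by
        rw [S.sol_eq, map_add]
      have e2 : S.P j (S.sol (a z) s) =
          S.P j (S.linearFlow s (a z)) + κ j z s + S.P j (S.linearFlow s (D z s)) := by
        rw [S.sol_eq, map_add]
        simp only [κ, D, map_sub]
        abel
      rw [e1, e2]
      refine (norm_sub_le_norm_sub_add_norm_sub _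
        (S.F j (S.P j (S.linearFlow s (a z)) + κ j z s)) _).trans (add_le_add ?_ le_rfl)
      refine ((S.lipschitz j).norm_sub_le _ _).trans ?_
      rw [add_sub_cancel_left, mul_assoc, mul_assoc]
      gcongr
      refine ((S.P j).le_opNorm _).trans ?_
      gcongr
      exact ((S.linearFlow s).le_opNorm _).trans (by gcongr; exact hu' s hs)
    have h2 : ‖S.perturbation (S.sol (a z) s) - S.perturbation (S.sol (b z) s)‖ ≤
        ∑ j, (S.lip * ‖S.P j‖ * u * ‖D z s‖ + η j z s) := by
      rw [perturbation, perturbation, ← Finset.sum_sub_distrib]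
      exact (norm_sum_le _ _).trans (Finset.sum_le_sum fun j _ => h1 j)
    calc ‖D' z s‖ ≤ u * ∑ j, (S.lip * ‖S.P j‖ * u * ‖D z s‖ + η j z s) := by
          refine ((S.linearFlow (-s)).le_opNorm _).trans (mul_le_mul ?_ h2 (norm_nonneg _) u.2)
          exact hu (-s) ⟨by linarith [hs.2], by linarith [hs.1]⟩
      _ = K * ‖D z s‖ + u * ∑ j, η j z s := by
          rw [Finset.sum_add_distrib, ← Finset.sum_mul, mul_add, mul_assoc]
  have hmain : ∀ z, ‖D z T‖ ≤ (u * ∑ j, ∫ s in (0 : ℝ)..T, η j z s) * Real.exp (K * T) := by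
    intro z
    refine le_mul_exp_of_le_integral hT hK (hDc z).norm fun t ht => ?_
    have h0 : D z 0 = 0 := by simp [D, displacement_zero]
    have h1 : ∫ s in (0 : ℝ)..t, D' z s = D z t := by
      rw [intervalIntegral.integral_eq_sub_of_hasDerivAt (fun s _ => hD z s)
        ((hD'c z).intervalIntegrable _ _), h0, sub_zero]
    have hηc : Continuous fun s => u * ∑ j, η j z s :=
      continuous_const.mul (continuous_finsetSum _ fun j _ => hη j z)
    have h2 : ‖D z t‖ ≤ ∫ s in (0 : ℝ)..t, (K * ‖D z s‖ + u * ∑ j, η j z s) := by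
      rw [← h1]
      refine (intervalIntegral.norm_integral_le_integral_norm ht.1).trans ?_
      refine intervalIntegral.integral_mono_on ht.1 ((hD'c z).norm.intervalIntegrable _ _)
        (((continuous_const.mul (hDc z).norm).add hηc).intervalIntegrable _ _) fun s hs => ?_
      exact hbound z s ⟨hs.1, hs.2.trans ht.2⟩
    have hKD : Continuous fun s => K * ‖D z s‖ := continuous_const.mul (hDc z).norm
    rw [intervalIntegral.integral_add (hKD.intervalIntegrable _ _)
      (hηc.intervalIntegrable _ _), intervalIntegral.integral_const_mul,
      intervalIntegral.integral_const_mul, intervalIntegral.integral_finsetSum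
        fun j _ => (hη j z).intervalIntegrable _ _] at h2
    have h3 : ∀ j, ∫ s in (0 : ℝ)..t, η j z s ≤ ∫ s in (0 : ℝ)..T, η j z s := fun j =>
      intervalIntegral.integral_mono_interval le_rfl ht.1 ht.2
        (Eventually.of_forall fun s => hη0 j z s) ((hη j z).intervalIntegrable _ _)
    have h4 := mul_le_mul_of_nonneg_left (Finset.sum_le_sum fun j (_ : j ∈ Finset.univ) => h3 j)
      u.coe_nonneg
    linarith
  rw [tendsto_zero_iff_norm_tendsto_zero]
  refine squeeze_zero (fun _ => norm_nonneg _) hmain ?_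
  simpa using hδ.mul_const (Real.exp (K * T))

theorem tendsto_displacement_sub [FiniteDimensional ℝ E] [ProperSpace G] (t : ℝ)
    {Z : Type*} {W : Ultrafilter Z} {a b : Z → E}
    (h : ∀ l : E →ₗ[ℝ] ℝ, Tendsto
      (fun z => 1 / (Complex.I - (l (a z) : ℂ)) - 1 / (Complex.I - (l (b z) : ℂ))) W (𝓝 0)) :
    Tendsto (fun z => S.displacement (a z) t - S.displacement (b z) t) W (𝓝 0) := by
  rcases le_total 0 t with ht | ht
  · exact S.tendsto_displacement_sub_of_nonneg ht h
  · have := S.reverse.tendsto_displacement_sub_of_nonneg (T := -t) (by linarith) h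
    simpa only [reverse_displacement, neg_neg] using this

end PerturbedLinearField

/-! ### Gradients of the pair potentials -/

section Gradient

variable {d : ℕ}

theorem norm_le_of_forall_abs_apply_single_le {L : EuclideanSpace ℝ (Fin d) →L[ℝ] ℝ} {M : ℝ}
    (h : ∀ i, |L (EuclideanSpace.single i 1)| ≤ M) : ‖L‖ ≤ d * M := by
  rcases Nat.eq_zero_or_pos d with rfl | hd
  · have : L = 0 := by ext x; rw [Subsingleton.elim x 0]; simp
    simp [this]
  have hM : 0 ≤ M := (abs_nonneg _).trans (h ⟨0, hd⟩)
  refine L.opNorm_le_bound (by positivity) fun x => ?_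
  have hx : x = ∑ i, x i • EuclideanSpace.single i (1 : ℝ) := by
    ext j
    simp [Finset.sum_apply, Pi.single_apply]
  have h1 : L x = ∑ i, x i * L (EuclideanSpace.single i 1) := by
    conv_lhs => rw [hx]
    simp
  rw [h1]
  refine (norm_sum_le _ _).trans ?_
  calc ∑ i, ‖x i * L (EuclideanSpace.single i 1)‖ ≤ ∑ i : Fin d, ‖x‖ * M := by
        refine Finset.sum_le_sum fun i _ => ?_
        rw [norm_mul]
        exact mul_le_mul (PiLp.norm_apply_le x i) (h i) (norm_nonneg _) (norm_nonneg _)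
    _ = d * M * ‖x‖ := by simp; ring

variable {V : EuclideanSpace ℝ (Fin d) → ℝ} {M c : ℝ}

theorem norm_gradient_le
    (hV : ∀ (n : ℕ) (σ : Fin n → Fin d) (x : EuclideanSpace ℝ (Fin d)),
      |iteratedFDeriv ℝ n V x (fun i => EuclideanSpace.single (σ i) (1 : ℝ))| ≤ M * c ^ n)
    (x : EuclideanSpace ℝ (Fin d)) : ‖∇ V x‖ ≤ d * (M * c) := by
  rw [gradient, LinearIsometryEquiv.norm_map]
  refine norm_le_of_forall_abs_apply_single_le fun i => ?_
  simpa using hV 1 (fun _ => i) x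

theorem norm_gradient_sub_le (hs : ContDiff ℝ (⊤ : ℕ∞) V)
    (hV : ∀ (n : ℕ) (σ : Fin n → Fin d) (x : EuclideanSpace ℝ (Fin d)),
      |iteratedFDeriv ℝ n V x (fun i => EuclideanSpace.single (σ i) (1 : ℝ))| ≤ M * c ^ n)
    (x y : EuclideanSpace ℝ (Fin d)) :
    ‖∇ V x - ∇ V y‖ ≤ d * (d * (M * c ^ 2)) * ‖x - y‖ := by
  rw [gradient, gradient, ← map_sub, LinearIsometryEquiv.norm_map, mul_assoc]
  refine norm_le_of_forall_abs_apply_single_le fun i => ?_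
  have hd : ContDiff ℝ 1 (fderiv ℝ V) := hs.fderiv_right (by norm_cast)
  have hd' : Differentiable ℝ (fderiv ℝ V) := hd.differentiable one_ne_zero
  let φ : EuclideanSpace ℝ (Fin d) → ℝ := fun z => fderiv ℝ V z (EuclideanSpace.single i 1)
  have hφ : ∀ z, HasFDerivAt φ
      ((ContinuousLinearMap.apply ℝ ℝ (EuclideanSpace.single i (1 : ℝ))).comp
        (fderiv ℝ (fderiv ℝ V) z)) z := fun z =>
    (ContinuousLinearMap.apply ℝ ℝ (EuclideanSpace.single i (1 : ℝ))).hasFDerivAt.comp z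
      (hd' z).hasFDerivAt
  have h := Convex.norm_image_sub_le_of_norm_hasFDerivWithin_le (s := Set.univ) (f := φ)
    (C := d * (M * c ^ 2)) (fun z _ => (hφ z).hasFDerivWithinAt) (fun z _ => by
      refine norm_le_of_forall_abs_apply_single_le fun j => ?_
      simpa [iteratedFDeriv_two_apply] using hV 2 ![j, i] z) convex_univ (Set.mem_univ y)
    (Set.mem_univ x)
  exact h

/-- A function that vanishes at infinity and has a Lipschitz gradient has a gradient that vanishes
at infinity: a step of length `s` in the direction of the gradient changes the function by
`s ‖∇ V x‖ + O(s²)`. -/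
theorem tendsto_gradient_zero {V : EuclideanSpace ℝ (Fin d) → ℝ} (hd : Differentiable ℝ V) {K : ℝ}
    (hK : ∀ x y, ‖∇ V x - ∇ V y‖ ≤ K * ‖x - y‖)
    (h0 : Tendsto V (cocompact _) (𝓝 0)) : Tendsto (∇ V) (cocompact _) (𝓝 0) := by
  have hK0 : ∀ x y, ‖∇ V x - ∇ V y‖ ≤ |K| * ‖x - y‖ := fun x y =>
    (hK x y).trans (by gcongr; exact le_abs_self K)
  rw [Metric.tendsto_nhds]
  intro ε hε
  -- With this step length the quadratic error is at most `s ε / 2`.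
  set s : ℝ := ε / (4 * (|K| + 1))
  have hs : 0 < s := by positivity
  have h1 := Metric.tendsto_nhds.1 h0 (s * ε / 8) (by positivity)
  rw [← Metric.cobounded_eq_cocompact, ← comap_norm_atTop, eventually_comap] at h1 ⊢
  obtain ⟨R, hR⟩ := eventually_atTop.1 h1
  filter_upwards [eventually_ge_atTop (R + s)] with r hr x hx
  rw [dist_zero_right]
  by_cases hg : ∇ V x = 0
  · simpa [hg] using hε
  have hgn : 0 < ‖∇ V x‖ := norm_pos_iff.2 hg
  set h : EuclideanSpace ℝ (Fin d) := (s * ‖∇ V x‖⁻¹) • ∇ V x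
  have hh : ‖h‖ = s := by
    rw [norm_smul, Real.norm_of_nonneg (by positivity), mul_assoc, inv_mul_cancel₀ hgn.ne', mul_one]
  have hfd : ∀ z, fderiv ℝ V z = InnerProductSpace.toDual ℝ _ (∇ V z) := fun z => by
    simp [gradient]
  have hmv := (convex_ball x (2 * s)).norm_image_sub_le_of_norm_fderiv_le' (f := V) (𝕜 := ℝ)
    (φ := fderiv ℝ V x) (C := |K| * (2 * s)) (fun z _ => hd z) (fun z hz => by
      rw [hfd, hfd, ← map_sub, LinearIsometryEquiv.norm_map]
      refine (hK0 z x).trans ?_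
      gcongr
      exact (mem_ball_iff_norm.1 hz).le) (Metric.mem_ball_self (by positivity))
    (show x + h ∈ Metric.ball x (2 * s) by
      rw [mem_ball_iff_norm, add_sub_cancel_left, hh]; linarith)
  rw [add_sub_cancel_left, hh] at hmv
  have hin : fderiv ℝ V x h = s * ‖∇ V x‖ := by
    rw [hfd, InnerProductSpace.toDual_apply_apply, inner_smul_right, real_inner_self_eq_norm_sq]
    field_simp
  rw [hin] at hmv
  have hVx := hR r (by linarith) x hx
  have hVxh := hR ‖x + h‖ (by
    have := norm_sub_le (x + h) h
    rw [add_sub_cancel_right, hh, hx] at this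
    linarith) (x + h) rfl
  rw [Real.dist_eq, sub_zero] at hVx hVxh
  rw [Real.norm_eq_abs] at hmv
  have h2 : s * ‖∇ V x‖ ≤ s * ε / 4 + |K| * (2 * s) * s := by
    have a1 := abs_lt.1 hVx
    have a2 := abs_lt.1 hVxh
    have a3 := abs_le.1 hmv
    linarith [a1.1, a1.2, a2.1, a2.2, a3.1, a3.2]
  have h3 : |K| * (2 * s) ≤ ε / 2 := by
    calc |K| * (2 * s) ≤ (|K| + 1) * (2 * s) := by gcongr; linarith
      _ = ε / 2 := by simp only [s]; field_simp; norm_num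
  have h4 : |K| * (2 * s) * s ≤ ε / 2 * s := by gcongr
  have h5 : s * ‖∇ V x‖ < s * ε := by
    have := mul_pos hs hε
    linarith
  exact lt_of_mul_lt_mul_left h5 hs.le

end Gradient

/-! ### Finite systems of sites in the phase space -/

namespace PhaseSpace

variable {Γ : Type*} {d : ℕ}

theorem ext_pq {w w' : PhaseSpace Γ d} (hp : ∀ k, p w k = p w' k) (hq : ∀ k, q w k = q w' k) :
    w = w' := by
  refine Subtype.ext (lp.ext (funext fun k => ?_))
  exact (WithLp.ofLp_injective 2) (Prod.ext (hp k) (hq k))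

/-- The phase space of the finite system `Λ`. It is a definition and not an abbreviation, so that
instances are not searched through the nested `L²` products. -/
def Local (d : ℕ) (Λ : Finset Γ) : Type _ := PiLp 2 fun _ : Λ => SitePhaseSpace d

noncomputable instance (Λ : Finset Γ) : NormedAddCommGroup (Local d Λ) :=
  inferInstanceAs (NormedAddCommGroup (PiLp 2 fun _ : Λ => SitePhaseSpace d))

noncomputable instance (Λ : Finset Γ) : InnerProductSpace ℝ (Local d Λ) :=
  inferInstanceAs (InnerProductSpace ℝ (PiLp 2 fun _ : Λ => SitePhaseSpace d))

instance (Λ : Finset Γ) : FiniteDimensional ℝ (Local d Λ) :=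
  inferInstanceAs (FiniteDimensional ℝ (PiLp 2 fun _ : Λ => SitePhaseSpace d))

instance (Λ : Finset Γ) : CompleteSpace (Local d Λ) := FiniteDimensional.complete ℝ _

variable {Λ : Finset Γ}

/-- The momentum at the site `k`. -/
noncomputable def siteP (k : Λ) : Local d Λ →L[ℝ] EuclideanSpace ℝ (Fin d) :=
  LinearMap.toContinuousLinearMap
    { toFun := fun x : PiLp 2 fun _ : Λ => SitePhaseSpace d => (x k).fst
      map_add' := fun _ _ => rfl
      map_smul' := fun _ _ => rfl }

/-- The position at the site `k`. -/
noncomputable def siteQ (k : Λ) : Local d Λ →L[ℝ] EuclideanSpace ℝ (Fin d) :=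
  LinearMap.toContinuousLinearMap
    { toFun := fun x : PiLp 2 fun _ : Λ => SitePhaseSpace d => (x k).snd
      map_add' := fun _ _ => rfl
      map_smul' := fun _ _ => rfl }

/-- The point with given momenta and positions. -/
noncomputable def ofPQ (Λ : Finset Γ) :
    ((Λ → EuclideanSpace ℝ (Fin d)) × (Λ → EuclideanSpace ℝ (Fin d))) →L[ℝ] Local d Λ :=
  LinearMap.toContinuousLinearMap
    { toFun := fun x => (WithLp.toLp 2 fun k => WithLp.toLp 2 (x.1 k, x.2 k) :
        PiLp 2 fun _ : Λ => SitePhaseSpace d)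
      map_add' := fun _ _ => rfl
      map_smul' := fun _ _ => rfl }

theorem ofPQ_site (x : Local d Λ) : ofPQ Λ (fun k => siteP k x, fun k => siteQ k x) = x := rfl

theorem local_ext {x y : Local d Λ} (hp : ∀ k, siteP k x = siteP k y)
    (hq : ∀ k, siteQ k x = siteQ k y) : x = y := by
  rw [← ofPQ_site x, ← ofPQ_site y, funext hp, funext hq]

theorem inner_local (x y : Local d Λ) :
    inner ℝ x y = ∑ k : Λ, (inner ℝ (siteP k x) (siteP k y) + inner ℝ (siteQ k x) (siteQ k y)) :=
  rfl

theorem hasDerivAt_local_iff {x : ℝ → Local d Λ} {x' : Local d Λ} {t : ℝ} :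
    HasDerivAt x x' t ↔ ∀ k, HasDerivAt (fun s => siteQ k (x s)) (siteQ k x') t ∧
      HasDerivAt (fun s => siteP k (x s)) (siteP k x') t := by
  constructor
  · exact fun h k => ⟨(siteQ k).hasFDerivAt.comp_hasDerivAt t h,
      (siteP k).hasFDerivAt.comp_hasDerivAt t h⟩
  · intro h
    exact (ofPQ Λ).hasFDerivAt.comp_hasDerivAt t
      ((hasDerivAt_pi.2 fun k => (h k).2).prodMk (hasDerivAt_pi.2 fun k => (h k).1))

theorem p_add (w w' : PhaseSpace Γ d) (k : Γ) : p (w + w') k = p w k + p w' k := rfl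

theorem q_add (w w' : PhaseSpace Γ d) (k : Γ) : q (w + w') k = q w k + q w' k := rfl

/-- The restriction of a configuration to the sites in `Λ`. -/
noncomputable def restrictTo (Λ : Finset Γ) : PhaseSpace Γ d →ₗ[ℝ] Local d Λ where
  toFun w := ofPQ Λ (fun k => p w k, fun k => q w k)
  map_add' _ _ := rfl
  map_smul' _ _ := rfl

@[simp]
theorem siteP_restrictTo (w : PhaseSpace Γ d) (k : Λ) : siteP k (restrictTo Λ w) = p w k := rfl

@[simp]
theorem siteQ_restrictTo (w : PhaseSpace Γ d) (k : Λ) : siteQ k (restrictTo Λ w) = q w k := rfl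

open Classical in
/-- The extension of a configuration of `Λ` by zero. -/
noncomputable def extendZero (Λ : Finset Γ) : Local d Λ →ₗ[ℝ] PhaseSpace Γ d where
  toFun e := ⟨⟨fun k => if h : k ∈ Λ then WithLp.toLp 2 (siteP ⟨k, h⟩ e, siteQ ⟨k, h⟩ e) else 0,
    (memℓp_zero (Λ.finite_toSet.subset fun k hk => by
      by_contra h
      exact hk (dif_neg h))).of_exponent_ge zero_le⟩,
    Λ.finite_toSet.subset fun k hk => by
      by_contra h
      exact hk (dif_neg h)⟩
  map_add' e e' := by
    refine Subtype.ext (lp.ext (funext fun k => ?_))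
    change (if h : k ∈ Λ then WithLp.toLp 2 (siteP ⟨k, h⟩ (e + e'), siteQ ⟨k, h⟩ (e + e')) else 0) =
      (if h : k ∈ Λ then WithLp.toLp 2 (siteP ⟨k, h⟩ e, siteQ ⟨k, h⟩ e) else 0) +
      (if h : k ∈ Λ then WithLp.toLp 2 (siteP ⟨k, h⟩ e', siteQ ⟨k, h⟩ e') else 0)
    by_cases h : k ∈ Λ
    · simp only [dif_pos h]; rfl
    · simp [h]
  map_smul' a e := by
    refine Subtype.ext (lp.ext (funext fun k => ?_))
    change (if h : k ∈ Λ then WithLp.toLp 2 (siteP ⟨k, h⟩ (a • e), siteQ ⟨k, h⟩ (a • e)) else 0) =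
      a • (if h : k ∈ Λ then WithLp.toLp 2 (siteP ⟨k, h⟩ e, siteQ ⟨k, h⟩ e) else 0 : SitePhaseSpace d)
    by_cases h : k ∈ Λ
    · simp only [dif_pos h]; rfl
    · simp [h]

theorem extendZero_apply_of_mem (e : Local d Λ) {k : Γ} (h : k ∈ Λ) :
    (extendZero Λ e : lp (fun _ : Γ => SitePhaseSpace d) 2) k =
      WithLp.toLp 2 (siteP ⟨k, h⟩ e, siteQ ⟨k, h⟩ e) := dif_pos h

theorem extendZero_apply_of_notMem (e : Local d Λ) {k : Γ} (h : k ∉ Λ) :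
    (extendZero Λ e : lp (fun _ : Γ => SitePhaseSpace d) 2) k = 0 := dif_neg h

theorem p_extendZero (e : Local d Λ) (k : Λ) : p (extendZero Λ e) k = siteP k e := by
  rw [p, extendZero_apply_of_mem e k.2]
  rfl

theorem q_extendZero (e : Local d Λ) (k : Λ) : q (extendZero Λ e) k = siteQ k e := by
  rw [q, extendZero_apply_of_mem e k.2]
  rfl

theorem p_extendZero_of_notMem (e : Local d Λ) {k : Γ} (h : k ∉ Λ) : p (extendZero Λ e) k = 0 := by
  rw [p, extendZero_apply_of_notMem e h]
  rfl

theorem q_extendZero_of_notMem (e : Local d Λ) {k : Γ} (h : k ∉ Λ) : q (extendZero Λ e) k = 0 := by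
  rw [q, extendZero_apply_of_notMem e h]
  rfl

theorem extendZero_mem_localSpace (e : Local d Λ) : extendZero Λ e ∈ localSpace (d := d) Λ :=
  fun _ hk => ⟨p_extendZero_of_notMem e hk, q_extendZero_of_notMem e hk⟩

theorem restrictTo_extendZero (e : Local d Λ) : restrictTo Λ (extendZero Λ e) = e :=
  local_ext (p_extendZero e) (q_extendZero e)

theorem inner_extendZero (e : Local d Λ) (w : PhaseSpace Γ d) :
    inner ℝ (extendZero Λ e) w = inner ℝ e (restrictTo Λ w) := by
  rw [Submodule.coe_inner, lp.inner_eq_tsum, inner_local,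
    tsum_eq_sum (s := Λ) fun k hk => by rw [extendZero_apply_of_notMem e hk, inner_zero_left],
    ← Finset.sum_coe_sort]
  exact Finset.sum_congr rfl fun k _ => by rw [extendZero_apply_of_mem e k.2]; rfl

theorem norm_extendZero (e : Local d Λ) : ‖extendZero Λ e‖ = ‖e‖ := by
  rw [← sq_eq_sq₀ (norm_nonneg _) (norm_nonneg _), ← real_inner_self_eq_norm_sq,
    ← real_inner_self_eq_norm_sq, inner_extendZero, restrictTo_extendZero]

theorem norm_restrictTo_le (w : PhaseSpace Γ d) : ‖restrictTo Λ w‖ ≤ ‖w‖ := by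
  have h : ‖restrictTo Λ w‖ * ‖restrictTo Λ w‖ ≤ ‖restrictTo Λ w‖ * ‖w‖ := by
    rw [← real_inner_self_eq_norm_mul_norm, ← inner_extendZero, ← norm_extendZero]
    exact real_inner_le_norm _ _
  rcases (norm_nonneg (restrictTo Λ w)).eq_or_lt with h0 | h0
  · rw [← h0]; exact norm_nonneg _
  · exact le_of_mul_le_mul_left h h0

theorem continuous_extendZero : Continuous (extendZero (d := d) Λ) :=
  AddMonoidHomClass.continuous_of_bound _ 1 fun e => by rw [norm_extendZero, one_mul]

theorem continuous_restrictTo : Continuous (restrictTo (d := d) Λ) :=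
  AddMonoidHomClass.continuous_of_bound _ 1 fun e => by rw [one_mul]; exact norm_restrictTo_le e

end PhaseSpace

/-! ### Hamilton's equations -/

namespace OscillatorSystem

variable {Γ : Type*} {d : ℕ} {S : OscillatorSystem Γ d} {C : Γ → Γ → ℝ} {CV : ℝ}

theorem IsAdmissible.differentiable (hS : S.IsAdmissible C CV) (k l : Γ) :
    Differentiable ℝ (S.V k l) := (hS.smooth k l).differentiable (by simp)

theorem IsAdmissible.gradient_diag (hS : S.IsAdmissible C CV) (k : Γ)
    (x : EuclideanSpace ℝ (Fin d)) : ∇ (S.V k k) x = 0 := by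
  have : S.V k k = fun _ => 0 := funext (hS.diag k)
  rw [this]
  exact gradient_fun_const _ _

theorem gradP_of_mem {Λ : Finset Γ} (p q : Γ → EuclideanSpace ℝ (Fin d)) {k : Γ} (hk : k ∈ Λ) :
    S.gradP Λ p q k = (S.m k)⁻¹ • p k := by
  classical
  apply HasGradientAt.gradient
  have h : ∀ i ∈ Λ, HasFDerivAt (fun u => ‖Function.update p k u i‖ ^ 2 / (2 * S.m i) +
      S.ν i * ‖q i‖ ^ 2 / 2)
      (if i = k then InnerProductSpace.toDual ℝ _ ((S.m k)⁻¹ • p k) else 0) (p k) := by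
    intro i _
    by_cases hi : i = k
    · subst hi
      simp only [Function.update_self, if_true]
      have h1 := ((hasStrictFDerivAt_norm_sq (p i)).hasFDerivAt.mul_const (2 * S.m i)⁻¹).add_const
        (S.ν i * ‖q i‖ ^ 2 / 2)
      refine (h1.congr_fderiv ?_)
      ext v
      simp [InnerProductSpace.toDual_apply_apply]
      ring
    · simp only [Function.update_of_ne hi, if_neg hi]
      exact hasFDerivAt_const _ _
  have h2 := (HasFDerivAt.fun_sum h).add_const (1 / 2 * ∑ i ∈ Λ, ∑ l ∈ Λ, S.V i l (q i - q l))
  rw [hasGradientAt_iff_hasFDerivAt]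
  refine h2.congr_fderiv ?_
  rw [Finset.sum_ite_eq' Λ k, if_pos hk]

theorem gradP_of_notMem {Λ : Finset Γ} (p q : Γ → EuclideanSpace ℝ (Fin d)) {k : Γ} (hk : k ∉ Λ) :
    S.gradP Λ p q k = 0 := by
  classical
  have : (fun u => S.hamiltonian Λ (Function.update p k u) q) = fun _ => S.hamiltonian Λ p q := by
    funext u
    unfold hamiltonian
    congr 1
    refine Finset.sum_congr rfl fun i hi => ?_
    rw [Function.update_of_ne (ne_of_mem_of_not_mem hi hk)]
  rw [gradP, this]
  exact gradient_fun_const _ _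

theorem gradQ_of_notMem {Λ : Finset Γ} (p q : Γ → EuclideanSpace ℝ (Fin d)) {k : Γ} (hk : k ∉ Λ) :
    S.gradQ Λ p q k = 0 := by
  classical
  have : (fun u => S.hamiltonian Λ p (Function.update q k u)) = fun _ => S.hamiltonian Λ p q := by
    funext u
    unfold hamiltonian
    congr 1
    · refine Finset.sum_congr rfl fun i hi => ?_
      rw [Function.update_of_ne (ne_of_mem_of_not_mem hi hk)]
    · congr 1
      refine Finset.sum_congr rfl fun i hi => Finset.sum_congr rfl fun l hl => ?_
      rw [Function.update_of_ne (ne_of_mem_of_not_mem hi hk),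
        Function.update_of_ne (ne_of_mem_of_not_mem hl hk)]
  rw [gradQ, this]
  exact gradient_fun_const _ _

/-- The factor `1 / 2` in front of the double sum cancels, since every pair is counted
twice. -/
theorem IsAdmissible.gradQ_of_mem (hS : S.IsAdmissible C CV) {Λ : Finset Γ}
    (p q : Γ → EuclideanSpace ℝ (Fin d)) {k : Γ} (hk : k ∈ Λ) :
    S.gradQ Λ p q k = S.ν k • q k + ∑ l ∈ Λ, ∇ (S.V k l) (q k - q l) := by
  classical
  apply HasGradientAt.gradient
  let D := InnerProductSpace.toDual ℝ (EuclideanSpace ℝ (Fin d))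
  have hV : ∀ i l x, HasFDerivAt (S.V i l) (D (∇ (S.V i l) x)) x := fun i l x =>
    hasGradientAt_iff_hasFDerivAt.1 (hS.differentiable i l x).hasGradientAt
  have h : ∀ i ∈ Λ, HasFDerivAt (fun u => ‖p i‖ ^ 2 / (2 * S.m i) +
      S.ν i * ‖Function.update q k u i‖ ^ 2 / 2)
      (if i = k then D (S.ν k • q k) else 0) (q k) := by
    intro i _
    by_cases hi : i = k
    · subst hi
      simp only [Function.update_self, if_true]
      have h1 := (((hasStrictFDerivAt_norm_sq (q i)).hasFDerivAt.const_mul (S.ν i)).mul_const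
        (2 : ℝ)⁻¹).const_add (‖p i‖ ^ 2 / (2 * S.m i))
      refine (h1.congr_fderiv ?_)
      ext v
      simp [D, InnerProductSpace.toDual_apply_apply]
      ring
    · simp only [Function.update_of_ne hi, if_neg hi]
      exact hasFDerivAt_const _ _
  have hpair : ∀ i ∈ Λ, ∀ l ∈ Λ, HasFDerivAt
      (fun u => S.V i l (Function.update q k u i - Function.update q k u l))
      ((if i = k then D (∇ (S.V k l) (q k - q l)) else 0) +
        (if l = k then D (∇ (S.V k i) (q k - q i)) else 0)) (q k) := by
    intro i _ l _
    by_cases hi : i = k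
    · by_cases hl : l = k
      · subst hi; subst hl
        simp only [hS.diag, hS.gradient_diag, if_true, map_zero, add_zero]
        exact hasFDerivAt_const _ _
      · subst hi
        simp only [Function.update_self, Function.update_of_ne hl, if_neg hl, if_true, add_zero]
        exact (hV i l (q i - q l)).comp (q i) ((hasFDerivAt_id (q i)).sub_const (q l))
    · by_cases hl : l = k
      · subst hl
        simp only [Function.update_self, Function.update_of_ne hi, if_neg hi, if_true, zero_add]
        have : (fun u => S.V i l (q i - u)) = fun u => S.V l i (u - q i) := by
          funext u
          rw [hS.symm, neg_sub]
        rw [this]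
        exact (hV l i (q l - q i)).comp (q l) ((hasFDerivAt_id (q l)).sub_const (q i))
      · simp only [Function.update_of_ne hi, Function.update_of_ne hl, if_neg hi, if_neg hl,
          add_zero]
        exact hasFDerivAt_const _ _
  have h2 := (HasFDerivAt.fun_sum h).add
    ((HasFDerivAt.fun_sum fun i hi => HasFDerivAt.fun_sum (hpair i hi)).const_mul (1 / 2 : ℝ))
  rw [hasGradientAt_iff_hasFDerivAt]
  refine h2.congr_fderiv ?_
  simp only [Finset.sum_add_distrib, Finset.sum_ite_eq', hk, if_true]
  rw [Finset.sum_comm]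
  simp only [Finset.sum_ite_eq', hk, if_true]
  rw [map_add, map_sum]
  simp only [D]
  module

end OscillatorSystem

namespace PhaseSpace

variable {Γ : Type*} {d : ℕ} {Λ : Finset Γ}

/-- The momentum `u` at the site `k`, as a point of the phase space of `Λ`. -/
noncomputable def momentumAt [DecidableEq Γ] (k : Λ) : EuclideanSpace ℝ (Fin d) →L[ℝ] Local d Λ :=
  (ofPQ Λ).comp ((ContinuousLinearMap.single ℝ (fun _ : Λ => EuclideanSpace ℝ (Fin d)) k).prod 0)

theorem siteP_momentumAt [DecidableEq Γ] (k i : Λ) (u : EuclideanSpace ℝ (Fin d)) :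
    siteP i (momentumAt k u) = if i = k then u else 0 := by
  change (Pi.single k u : Λ → EuclideanSpace ℝ (Fin d)) i = _
  rw [Pi.single_apply]

theorem siteQ_momentumAt [DecidableEq Γ] (k i : Λ) (u : EuclideanSpace ℝ (Fin d)) :
    siteQ i (momentumAt k u) = 0 := rfl

end PhaseSpace

namespace OscillatorSystem

open PhaseSpace

variable {Γ : Type*} {d : ℕ} {S : OscillatorSystem Γ d} {C : Γ → Γ → ℝ} {CV : ℝ}

theorem IsAdmissible.norm_gradient_sub_le (hS : S.IsAdmissible C CV) (k l : Γ)
    (x y : EuclideanSpace ℝ (Fin d)) :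
    ‖∇ (S.V k l) x - ∇ (S.V k l) y‖ ≤ d * (d * (C k l * CV ^ 2)) * ‖x - y‖ :=
  _root_.norm_gradient_sub_le (hS.smooth k l) (hS.deriv_bound k l) x y

theorem IsAdmissible.norm_gradient_le (hS : S.IsAdmissible C CV) (k l : Γ)
    (x : EuclideanSpace ℝ (Fin d)) : ‖∇ (S.V k l) x‖ ≤ d * (C k l * CV) :=
  _root_.norm_gradient_le (hS.deriv_bound k l) x

open Classical in
/-- Hamilton's equations in the finite system `Λ`, as a perturbation of uncoupled harmonic
oscillators by the pair forces. -/
noncomputable def IsAdmissible.localField (hS : S.IsAdmissible C CV) (Λ : Finset Γ) :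
    PerturbedLinearField (Local d Λ) (EuclideanSpace ℝ (Fin d)) (Λ × Λ) where
  A := (ofPQ Λ).comp ((ContinuousLinearMap.pi fun k : Λ => -(S.ν k • siteQ k)).prod
    (ContinuousLinearMap.pi fun k : Λ => (S.m k)⁻¹ • siteP k))
  P j := siteQ j.1 - siteQ j.2
  F j u := momentumAt j.1 (-∇ (S.V j.1 j.2) u)
  lip := ∑ j : Λ × Λ, ‖momentumAt (d := d) j.1‖₊ * (d * (d * (C j.1 j.2 * CV ^ 2))).toNNReal
  bound := ∑ j : Λ × Λ, ‖momentumAt (d := d) j.1‖₊ * (d * (C j.1 j.2 * CV)).toNNReal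
  lipschitz j := by
    have h : LipschitzWith (d * (d * (C j.1 j.2 * CV ^ 2))).toNNReal
        fun u => -∇ (S.V j.1 j.2) u :=
      (LipschitzWith.of_dist_le_mul fun x y => by
        rw [dist_eq_norm, dist_eq_norm]
        exact (hS.norm_gradient_sub_le _ _ x y).trans
          (by gcongr; exact Real.le_coe_toNNReal _)).neg
    exact ((momentumAt j.1).lipschitz.comp h).weaken
      (Finset.single_le_sum (f := fun j : Λ × Λ => ‖momentumAt (d := d) j.1‖₊ *
        (d * (d * (C j.1 j.2 * CV ^ 2))).toNNReal) (fun _ _ => zero_le) (Finset.mem_univ j))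
  norm_le j u := by
    have h : ‖momentumAt j.1 (-∇ (S.V j.1 j.2) u)‖₊ ≤
        ‖momentumAt (d := d) j.1‖₊ * (d * (C j.1 j.2 * CV)).toNNReal := by
      refine ((momentumAt j.1).le_opNNNorm _).trans ?_
      gcongr
      rw [nnnorm_neg]
      exact (hS.norm_gradient_le _ _ u).trans (Real.le_coe_toNNReal _)
    exact h.trans
      (Finset.single_le_sum (f := fun j : Λ × Λ => ‖momentumAt (d := d) j.1‖₊ *
        (d * (C j.1 j.2 * CV)).toNNReal) (fun _ _ => zero_le) (Finset.mem_univ j))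
  vanishing j := by
    have h := (tendsto_gradient_zero (hS.differentiable _ _) (hS.norm_gradient_sub_le j.1 j.2)
      (hS.vanishing j.1 j.2)).neg
    have h2 := ((momentumAt (d := d) j.1).continuous.tendsto _).comp h
    rwa [neg_zero, map_zero] at h2

variable (hS : S.IsAdmissible C CV) {Λ : Finset Γ}

theorem IsAdmissible.siteQ_localField (x : Local d Λ) (k : Λ) :
    siteQ k ((hS.localField Λ).field x) = (S.m k)⁻¹ • siteP k x := by
  classical
  have h : siteQ k ((hS.localField Λ).perturbation x) = 0 := by
    rw [PerturbedLinearField.perturbation, map_sum]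
    exact Finset.sum_eq_zero fun j _ => siteQ_momentumAt _ _ _
  rw [PerturbedLinearField.field, map_add, h, add_zero]
  rfl

theorem IsAdmissible.siteP_localField (x : Local d Λ) (k : Λ) :
    siteP k ((hS.localField Λ).field x) =
      -(S.ν k • siteQ k x + ∑ l : Λ, ∇ (S.V k l) (siteQ k x - siteQ l x)) := by
  classical
  have h : siteP k ((hS.localField Λ).perturbation x) =
      -∑ l : Λ, ∇ (S.V k l) (siteQ k x - siteQ l x) := by
    rw [PerturbedLinearField.perturbation, map_sum, Fintype.sum_prod_type,
      Finset.sum_eq_single k, ← Finset.sum_neg_distrib]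
    · exact Finset.sum_congr rfl fun l _ => (siteP_momentumAt _ _ _).trans (if_pos rfl)
    · intro i _ hi
      exact Finset.sum_eq_zero fun l _ => (siteP_momentumAt _ _ _).trans (if_neg hi.symm)
    · exact fun h => absurd (Finset.mem_univ k) h
  rw [PerturbedLinearField.field, map_add, h, neg_add]
  rfl

/-- The Hamiltonian flow: the sites in `Λ` follow the integral curve of the finite system. -/
noncomputable def IsAdmissible.localFlow (Λ : Finset Γ) (t : ℝ) (w : PhaseSpace Γ d) :
    PhaseSpace Γ d :=
  w + extendZero Λ ((hS.localField Λ).sol (restrictTo Λ w) t - restrictTo Λ w)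

theorem IsAdmissible.localFlow_zero (w : PhaseSpace Γ d) : hS.localFlow Λ 0 w = w := by
  simp [localFlow, PerturbedLinearField.sol_zero]

theorem IsAdmissible.restrictTo_localFlow (t : ℝ) (w : PhaseSpace Γ d) :
    restrictTo Λ (hS.localFlow Λ t w) = (hS.localField Λ).sol (restrictTo Λ w) t := by
  simp [localFlow, restrictTo_extendZero]

theorem IsAdmissible.p_localFlow_of_notMem (t : ℝ) (w : PhaseSpace Γ d) {k : Γ} (hk : k ∉ Λ) :
    p (hS.localFlow Λ t w) k = p w k := by
  rw [localFlow, p_add, p_extendZero_of_notMem _ hk, add_zero]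

theorem IsAdmissible.q_localFlow_of_notMem (t : ℝ) (w : PhaseSpace Γ d) {k : Γ} (hk : k ∉ Λ) :
    q (hS.localFlow Λ t w) k = q w k := by
  rw [localFlow, q_add, q_extendZero_of_notMem _ hk, add_zero]

theorem IsAdmissible.localFlow_add (s t : ℝ) (w : PhaseSpace Γ d) :
    hS.localFlow Λ (s + t) w = hS.localFlow Λ s (hS.localFlow Λ t w) := by
  conv_rhs => rw [localFlow, restrictTo_localFlow, ← PerturbedLinearField.sol_add, localFlow]
  rw [localFlow, add_assoc, ← map_add]
  congr 2
  abel

theorem IsAdmissible.continuous_localFlow (t : ℝ) : Continuous (hS.localFlow Λ t) :=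
  continuous_id.add (continuous_extendZero.comp
    ((((hS.localField Λ).continuous_sol_apply t).comp continuous_restrictTo).sub continuous_restrictTo))

theorem IsAdmissible.isTrajectory_localFlow (w : PhaseSpace Γ d) :
    S.IsTrajectory Λ fun t => hS.localFlow Λ t w := by
  intro t k
  by_cases hk : k ∈ Λ
  · rw [gradP_of_mem _ _ hk, hS.gradQ_of_mem _ _ hk]
    have h := hasDerivAt_local_iff.1 ((hS.localField Λ).hasDerivAt_sol (restrictTo Λ w) t) ⟨k, hk⟩
    rw [hS.siteP_localField, hS.siteQ_localField] at h
    simp only [← hS.restrictTo_localFlow, siteP_restrictTo, siteQ_restrictTo] at h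
    rw [Finset.sum_coe_sort Λ fun l => ∇ (S.V k l)
      (q (hS.localFlow Λ t w) k - q (hS.localFlow Λ t w) l)] at h
    exact h
  · rw [gradP_of_notMem _ _ hk, gradQ_of_notMem _ _ hk, neg_zero]
    simp only [hS.p_localFlow_of_notMem _ _ hk, hS.q_localFlow_of_notMem _ _ hk]
    exact ⟨hasDerivAt_const _ _, hasDerivAt_const _ _⟩

theorem IsAdmissible.eq_localFlow {γ : ℝ → PhaseSpace Γ d} (h : S.IsTrajectory Λ γ) (t : ℝ) :
    γ t = hS.localFlow Λ t (γ 0) := by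
  have h1 : (fun t => restrictTo Λ (γ t)) = (hS.localField Λ).sol (restrictTo Λ (γ 0)) := by
    refine (hS.localField Λ).eq_sol fun t => hasDerivAt_local_iff.2 fun k => ?_
    have hk := h t k
    rw [gradP_of_mem _ _ k.2, hS.gradQ_of_mem _ _ k.2, ← Finset.sum_coe_sort] at hk
    rw [hS.siteP_localField, hS.siteQ_localField]
    exact hk
  have h2 : restrictTo Λ (γ t) = restrictTo Λ (hS.localFlow Λ t (γ 0)) := by
    rw [hS.restrictTo_localFlow, ← h1]
  have hconst : ∀ {f : ℝ → EuclideanSpace ℝ (Fin d)}, (∀ s, HasDerivAt f 0 s) → f t = f 0 :=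
    fun hf => is_const_of_deriv_eq_zero (fun s => (hf s).differentiableAt) (fun s => (hf s).deriv) _ _
  refine ext_pq (fun k => ?_) fun k => ?_
  · by_cases hk : k ∈ Λ
    · exact congrArg (siteP ⟨k, hk⟩) h2
    · rw [hS.p_localFlow_of_notMem _ _ hk]
      refine hconst (f := fun s => p (γ s) k) fun s => ?_
      have := (h s k).2
      rwa [gradQ_of_notMem _ _ hk, neg_zero] at this
  · by_cases hk : k ∈ Λ
    · exact congrArg (siteQ ⟨k, hk⟩) h2
    · rw [hS.q_localFlow_of_notMem _ _ hk]
      refine hconst (f := fun s => q (γ s) k) fun s => ?_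
      have := (h s k).1
      rwa [gradP_of_notMem _ _ hk] at this

include hS in
theorem IsAdmissible.existsUnique_trajectory (Λ : Finset Γ) (w : PhaseSpace Γ d) :
    ∃! γ : ℝ → PhaseSpace Γ d, γ 0 = w ∧ S.IsTrajectory Λ γ := by
  refine ⟨fun t => hS.localFlow Λ t w, ⟨hS.localFlow_zero w, hS.isTrajectory_localFlow w⟩, ?_⟩
  rintro γ ⟨h0, hγ⟩
  funext t
  rw [hS.eq_localFlow hγ t, h0]

theorem IsAdmissible.flow_eq (Λ : Finset Γ) (t : ℝ) (w : PhaseSpace Γ d) :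
    S.flow Λ t w = hS.localFlow Λ t w := by
  have h : ∃ γ : ℝ → PhaseSpace Γ d, γ 0 = w ∧ S.IsTrajectory Λ γ :=
    (hS.existsUnique_trajectory Λ w).exists
  rw [flow, dif_pos h, hS.eq_localFlow h.choose_spec.2 t, h.choose_spec.1]

end OscillatorSystem

/-! ### Invariance of the resolvent algebra -/

theorem PerturbedLinearField.exists_forall_norm_displacement_le {E G J : Type*}
    [NormedAddCommGroup E] [NormedSpace ℝ E] [NormedAddCommGroup G] [NormedSpace ℝ G]
    [Fintype J] [CompleteSpace E] (S : PerturbedLinearField E G J) (t : ℝ) :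
    ∃ C, ∀ w, ‖S.displacement w t‖ ≤ C := by
  rcases le_total 0 t with ht | ht
  · obtain ⟨C, hC⟩ := S.exists_norm_displacement_le ht
    exact ⟨C, fun w => hC w t ⟨ht, le_rfl⟩⟩
  · obtain ⟨C, hC⟩ := S.reverse.exists_norm_displacement_le (T := -t) (by linarith)
    refine ⟨C, fun w => ?_⟩
    have := hC w (-t) ⟨by linarith, le_rfl⟩
    rwa [S.reverse_displacement, neg_neg] at this

theorem norm_resolvent_sub_le {r : ℝ} (hr : r ≠ 0) (u v : ℝ) :
    ‖1 / (Complex.I * (r : ℂ) - (u : ℂ)) - 1 / (Complex.I * (r : ℂ) - (v : ℂ))‖ ≤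
      |u - v| / |r| ^ 2 := by
  have e1 := ResolventAlgebra.sub_ne_zero_of_ne hr u
  have e2 := ResolventAlgebra.sub_ne_zero_of_ne hr v
  have h : 1 / (Complex.I * (r : ℂ) - (u : ℂ)) - 1 / (Complex.I * (r : ℂ) - (v : ℂ)) =
      ((u - v : ℝ) : ℂ) / ((Complex.I * (r : ℂ) - (u : ℂ)) * (Complex.I * (r : ℂ) - (v : ℂ))) := by
    field_simp
    push_cast
    ring
  rw [h, norm_div, norm_mul, Complex.norm_real, Real.norm_eq_abs, sq]
  have := abs_pos.2 hr
  gcongr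
  · exact ResolventAlgebra.abs_le_norm_sub r u
  · exact ResolventAlgebra.abs_le_norm_sub r v

theorem tendsto_resolvent_of_abs_tendsto_atTop {Z : Type*} {l : Filter Z} {u : Z → ℝ} (r : ℝ)
    (h : Tendsto (fun z => |u z|) l atTop) :
    Tendsto (fun z => 1 / (Complex.I * (r : ℂ) - (u z : ℂ))) l (𝓝 0) := by
  have h1 : Tendsto (fun z => ‖Complex.I * (r : ℂ) - (u z : ℂ)‖) l atTop := by
    refine tendsto_atTop_mono (fun z => ?_) h
    simpa using Complex.abs_re_le_norm (Complex.I * (r : ℂ) - (u z : ℂ))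
  rw [tendsto_zero_iff_norm_tendsto_zero]
  simpa [Pi.inv_def] using h1.inv_tendsto_atTop

/-- Asymptotic equality of resolvents is stable under bounded, asymptotically equal
perturbations. -/
theorem tendsto_resolvent_sub_of_perturbation {Z : Type*} {W : Ultrafilter Z} {u v k l : Z → ℝ}
    {C r : ℝ} (hr : r ≠ 0)
    (h : Tendsto (fun z => 1 / (Complex.I - (u z : ℂ)) - 1 / (Complex.I - (v z : ℂ))) W (𝓝 0))
    (hk : ∀ z, |k z| ≤ C) (hl : ∀ z, |l z| ≤ C) (hkl : Tendsto (fun z => k z - l z) W (𝓝 0)) :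
    Tendsto (fun z => 1 / (Complex.I * (r : ℂ) - ((u z + k z : ℝ) : ℂ)) -
      1 / (Complex.I * (r : ℂ) - ((v z + l z : ℝ) : ℂ))) W (𝓝 0) := by
  rcases abs_tendsto_atTop_or_tendsto_sub h with ⟨hu, hv⟩ | huv
  · have key : ∀ {a b : Z → ℝ}, Tendsto (fun z => |a z|) W atTop → (∀ z, |b z| ≤ C) →
        Tendsto (fun z => |a z + b z|) W atTop := fun {a b} ha hb => by
      refine tendsto_atTop_mono (fun z => ?_) (tendsto_atTop_add_const_right _ (-C) ha)
      have h1 := abs_sub (a z + b z) (b z)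
      rw [add_sub_cancel_right] at h1
      linarith [hb z]
    simpa using (tendsto_resolvent_of_abs_tendsto_atTop r (key hu hk)).sub
      (tendsto_resolvent_of_abs_tendsto_atTop r (key hv hl))
  · have hlim := (tendsto_zero_iff_norm_tendsto_zero.1 (huv.add hkl |>.trans (by simp))).div_const
      (|r| ^ 2)
    rw [zero_div] at hlim
    refine squeeze_zero_norm (fun z => (norm_resolvent_sub_le hr _ _).trans (le_of_eq ?_)) hlim
    rw [Real.norm_eq_abs]
    congr 2
    ring

namespace OscillatorSystem

open PhaseSpace ResolventAlgebra

variable {Γ : Type*} {d : ℕ} {S : OscillatorSystem Γ d} {C : Γ → Γ → ℝ} {CV : ℝ}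
  (hS : S.IsAdmissible C CV) {Λ : Finset Γ}

/-- Composition with the Hamiltonian flow. -/
noncomputable def IsAdmissible.evolution (Λ : Finset Γ) (t : ℝ) :
    (PhaseSpace Γ d →ᵇ ℂ) →⋆ₐ[ℂ] (PhaseSpace Γ d →ᵇ ℂ) :=
  pullback ⟨hS.localFlow Λ t, hS.continuous_localFlow t⟩

theorem IsAdmissible.evolution_apply (t : ℝ) (f : PhaseSpace Γ d →ᵇ ℂ) (w : PhaseSpace Γ d) :
    hS.evolution Λ t f w = f (hS.localFlow Λ t w) := rfl

/-- The local evolution maps resolvent functions into the resolvent algebra. -/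
theorem IsAdmissible.evolution_resolventFunction_mem {K : Submodule ℝ (PhaseSpace Γ d)}
    (hK : localSpace Λ ≤ K) (t : ℝ) {x : PhaseSpace Γ d} (hx : x ∈ K) {r : ℝ} (hr : r ≠ 0) :
    hS.evolution Λ t (resolventFunction x r hr) ∈ algebraOn K := by
  refine mem_closure_adjoin_of_tendsto _ _ (tendsto_iff_ultrafilter _ _ _ |>.2 fun W hW => ?_)
  have hgen : ∀ y ∈ K, Tendsto (fun z : PhaseSpace Γ d × PhaseSpace Γ d =>
      1 / (Complex.I - ((inner ℝ y z.1 : ℝ) : ℂ)) - 1 / (Complex.I - ((inner ℝ y z.2 : ℝ) : ℂ)))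
      W (𝓝 0) := by
    intro y hy
    have h1 : (W : Filter _) ≤ comap (fun z : PhaseSpace Γ d × PhaseSpace Γ d =>
        resolventFunction y 1 one_ne_zero z.1 - resolventFunction y 1 one_ne_zero z.2) (𝓝 0) :=
      hW.trans (iInf₂_le _ ⟨y, hy, 1, one_ne_zero, rfl⟩)
    have h2 := tendsto_iff_comap.2 h1
    simpa [resolventFunction] using h2
  let U := (hS.localField Λ).linearFlow t
  -- The linear part of `w ↦ ⟪x, Φ_t w⟫` is the inner product with a vector of `K`.
  have hlin : ∀ l : Local d Λ →ₗ[ℝ] ℝ, ∃ y ∈ K, ∀ w, l (restrictTo Λ w) = inner ℝ y w := by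
    intro l
    refine ⟨extendZero Λ ((InnerProductSpace.toDual ℝ _).symm l.toContinuousLinearMap),
      hK (extendZero_mem_localSpace _), fun w => ?_⟩
    rw [inner_extendZero, InnerProductSpace.toDual_symm_apply]
    rfl
  have hdisp := (hS.localField Λ).tendsto_displacement_sub t (W := W)
    (a := fun z => restrictTo Λ z.1) (b := fun z => restrictTo Λ z.2) fun l => by
      obtain ⟨y, hy, hly⟩ := hlin l
      simpa only [hly] using hgen y hy
  obtain ⟨B, hB⟩ := (hS.localField Λ).exists_forall_norm_displacement_le t
  obtain ⟨y, hy, hxy⟩ := hlin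
    ((innerSL ℝ (restrictTo Λ x)).comp (U - 1) : Local d Λ →L[ℝ] ℝ)
  let L : Local d Λ →L[ℝ] ℝ := (innerSL ℝ (restrictTo Λ x)).comp U
  have hflow : ∀ w, inner ℝ x (hS.localFlow Λ t w) = inner ℝ (x + y) w +
      L ((hS.localField Λ).displacement (restrictTo Λ w) t) := by
    intro w
    have h2 : inner ℝ y w = inner ℝ (restrictTo Λ x) (U (restrictTo Λ w)) -
        inner ℝ (restrictTo Λ x) (restrictTo Λ w) := by
      rw [← hxy]
      simp
    have h3 : inner ℝ x (extendZero Λ ((hS.localField Λ).sol (restrictTo Λ w) t - restrictTo Λ w)) =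
        inner ℝ (restrictTo Λ x) ((hS.localField Λ).sol (restrictTo Λ w) t - restrictTo Λ w) := by
      rw [real_inner_comm, inner_extendZero, real_inner_comm]
    rw [localFlow, inner_add_right, h3, (hS.localField Λ).sol_eq, inner_add_left, h2,
      inner_sub_right, inner_add_right]
    change _ = _ + inner ℝ (restrictTo Λ x) (U _)
    ring
  have hbd : ∀ w, |L ((hS.localField Λ).displacement (restrictTo Λ w) t)| ≤ ‖L‖ * B := fun w =>
    (L.le_opNorm _).trans (by gcongr; exact hB _)
  have h := tendsto_resolvent_sub_of_perturbation hr (hgen (x + y) (K.add_mem hx hy))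
    (fun z => hbd z.1) (fun z => hbd z.2) (by
      have h4 := (L.continuous.tendsto 0).comp hdisp
      rw [map_zero] at h4
      exact h4.congr fun z => map_sub L _ _)
  simp only [← hflow] at h
  exact h

theorem IsAdmissible.evolution_mem {K : Submodule ℝ (PhaseSpace Γ d)}
    (hK : localSpace Λ ≤ K) (t : ℝ) {f : PhaseSpace Γ d →ᵇ ℂ} (hf : f ∈ algebraOn K) :
    hS.evolution Λ t f ∈ algebraOn K := by
  have hle : algebraOn K ≤ (algebraOn K).comap (hS.evolution Λ t) := by
    refine StarSubalgebra.closure_adjoin_le ?_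
      ((StarSubalgebra.isClosed_topologicalClosure _).preimage (continuous_pullback _))
    rintro _ ⟨x, hx, r, hr, rfl⟩
    exact hS.evolution_resolventFunction_mem hK t hx hr
  exact hle hf

end OscillatorSystem

/-! ### Limits of one-parameter groups -/

/-- A one-parameter group of star endomorphisms consists of automorphisms. -/
noncomputable def oneParameterGroup {R : Type*} [Ring R] [StarRing R] [Algebra ℂ R]
    (a : ℝ → R →⋆ₐ[ℂ] R) (h0 : ∀ f, a 0 f = f) (hadd : ∀ s t f, a (s + t) f = a s (a t f)) :
    Multiplicative ℝ →* (R ≃⋆ₐ[ℂ] R) where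
  toFun t := StarAlgEquiv.ofStarAlgHom (a t.toAdd) (a (-t.toAdd))
    (StarAlgHom.ext fun f => by
      change a (-t.toAdd) (a t.toAdd f) = f
      rw [← hadd, neg_add_cancel, h0])
    (StarAlgHom.ext fun f => by
      change a t.toAdd (a (-t.toAdd) f) = f
      rw [← hadd, add_neg_cancel, h0])
  map_one' := StarAlgEquiv.ext fun f => h0 f
  map_mul' s t := StarAlgEquiv.ext fun f => hadd s.toAdd t.toAdd f

theorem oneParameterGroup_apply {R : Type*} [Ring R] [StarRing R] [Algebra ℂ R]
    (a : ℝ → R →⋆ₐ[ℂ] R) (h0 : ∀ f, a 0 f = f) (hadd : ∀ s t f, a (s + t) f = a s (a t f)) (t : ℝ)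
    (f : R) : oneParameterGroup a h0 hadd (Multiplicative.ofAdd t) f = a t f := rfl

section Limit

variable {ι A : Type*} [Preorder ι] [NormedRing A] [StarRing A] [NormedStarGroup A]
  [NormedAlgebra ℂ A] [StarModule ℂ A] {φ : ι → ℝ → A →⋆ₐ[ℂ] A}

/-- The elements of `A` on which a net of contractive families of homomorphisms is Cauchy, uniformly
on compact time intervals. -/
def cauchySubalgebra (φ : ι → ℝ → A →⋆ₐ[ℂ] A) (hφ : ∀ i t f, ‖φ i t f‖ ≤ ‖f‖) :
    StarSubalgebra ℂ A where
  carrier := {f | ∀ T ε : ℝ, 0 < ε → ∀ᶠ i in atTop, ∀ j ≥ i, ∀ t ∈ Set.Icc (-T) T,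
    ‖φ i t f - φ j t f‖ ≤ ε}
  mul_mem' := by
    intro f g hf hg T ε hε
    have hδ : 0 < ε / (‖f‖ + ‖g‖ + 1) := by positivity
    filter_upwards [hf T _ hδ, hg T _ hδ] with i hi hi' j hj t ht
    have h : φ i t (f * g) - φ j t (f * g) =
        (φ i t f - φ j t f) * φ i t g + φ j t f * (φ i t g - φ j t g) := by
      simp only [map_mul]
      noncomm_ring
    rw [h]
    calc _ ≤ ‖φ i t f - φ j t f‖ * ‖φ i t g‖ + ‖φ j t f‖ * ‖φ i t g - φ j t g‖ :=
          (norm_add_le _ _).trans (add_le_add (norm_mul_le _ _) (norm_mul_le _ _))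
      _ ≤ ε / (‖f‖ + ‖g‖ + 1) * ‖g‖ + ‖f‖ * (ε / (‖f‖ + ‖g‖ + 1)) := by
          gcongr
          · exact hi j hj t ht
          · exact hφ i t g
          · exact hφ j t f
          · exact hi' j hj t ht
      _ = ε / (‖f‖ + ‖g‖ + 1) * (‖f‖ + ‖g‖) := by ring
      _ ≤ ε / (‖f‖ + ‖g‖ + 1) * (‖f‖ + ‖g‖ + 1) :=
          mul_le_mul_of_nonneg_left (by linarith) hδ.le
      _ = ε := by field_simp
  add_mem' := by
    intro f g hf hg T ε hε
    filter_upwards [hf T _ (half_pos hε), hg T _ (half_pos hε)] with i hi hi' j hj t ht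
    rw [map_add, map_add, add_sub_add_comm]
    linarith [norm_add_le (φ i t f - φ j t f) (φ i t g - φ j t g), hi j hj t ht, hi' j hj t ht]
  algebraMap_mem' := by
    intro c T ε hε
    refine Eventually.of_forall fun i j _ t _ => ?_
    rw [AlgHomClass.commutes, AlgHomClass.commutes, sub_self, norm_zero]
    exact hε.le
  star_mem' := by
    intro f hf T ε hε
    filter_upwards [hf T ε hε] with i hi j hj t ht
    rw [map_star, map_star, ← star_sub, norm_star]
    exact hi j hj t ht

theorem isClosed_cauchySubalgebra (hφ : ∀ i t f, ‖φ i t f‖ ≤ ‖f‖) :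
    IsClosed (cauchySubalgebra φ hφ : Set A) := by
  refine isClosed_of_closure_subset fun f hf T ε hε => ?_
  obtain ⟨g, hg, hfg⟩ := Metric.mem_closure_iff.1 hf (ε / 3) (by positivity)
  filter_upwards [hg T (ε / 3) (by positivity)] with i hi j hj t ht
  have h : φ i t f - φ j t f = φ i t (f - g) + (φ i t g - φ j t g) - φ j t (f - g) := by
    simp only [map_sub]
    abel
  rw [h]
  rw [dist_eq_norm] at hfg
  have h1 := norm_sub_le (φ i t (f - g) + (φ i t g - φ j t g)) (φ j t (f - g))
  have h2 := norm_add_le (φ i t (f - g)) (φ i t g - φ j t g)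
  linarith [hφ i t (f - g), hφ j t (f - g), hi j hj t ht]

variable [IsDirectedOrder ι] [Nonempty ι] [CompleteSpace A]

theorem exists_tendsto_of_mem_cauchySubalgebra (hφ : ∀ i t f, ‖φ i t f‖ ≤ ‖f‖) {f : A}
    (hf : f ∈ cauchySubalgebra φ hφ) (t : ℝ) : ∃ g, Tendsto (fun i => φ i t f) atTop (𝓝 g) := by
  refine cauchySeq_tendsto_of_complete (Metric.cauchy_iff.2 ⟨inferInstance, fun ε hε => ?_⟩)
  obtain ⟨i, hi⟩ := (hf |t| (ε / 3) (by positivity)).exists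
  refine ⟨_, image_mem_map (Ici_mem_atTop i), ?_⟩
  rintro _ ⟨j, hj, rfl⟩ _ ⟨k, hk, rfl⟩
  have ht : t ∈ Set.Icc (-|t|) |t| := ⟨neg_abs_le t, le_abs_self t⟩
  have h1 := dist_triangle_left (φ j t f) (φ k t f) (φ i t f)
  rw [dist_eq_norm (φ i t f), dist_eq_norm (φ i t f)] at h1
  linarith [hi j hj t ht, hi k hk t ht]

/-- A net of contractive one-parameter groups that is Cauchy on a closed invariant subalgebra
converges there to a one-parameter group, uniformly on compact time intervals. -/
theorem exists_limit_oneParameterGroup {R : StarSubalgebra ℂ A} (hR : IsClosed (R : Set A))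
    (hφ : ∀ i t f, ‖φ i t f‖ ≤ ‖f‖) (hinv : ∀ i t, ∀ f ∈ R, φ i t f ∈ R)
    (h0 : ∀ i f, φ i 0 f = f) (hadd : ∀ i s t f, φ i (s + t) f = φ i s (φ i t f))
    (hle : R ≤ cauchySubalgebra φ hφ) :
    ∃ α : Multiplicative ℝ →* (R ≃⋆ₐ[ℂ] R), ∀ (f : R) (T : ℝ),
      TendstoUniformlyOn (fun i t => φ i t (f : A))
        (fun t => (α (Multiplicative.ofAdd t) f : A)) atTop (Set.Icc (-T) T) := by
  choose L hL using fun (f : R) t => exists_tendsto_of_mem_cauchySubalgebra hφ (hle f.2) t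
  have hLR : ∀ f t, L f t ∈ R := fun f t =>
    hR.mem_of_tendsto (hL f t) (Eventually.of_forall fun i => hinv i t f f.2)
  let a : ℝ → R →⋆ₐ[ℂ] R := fun t =>
    { toFun := fun f => ⟨L f t, hLR f t⟩
      map_one' := Subtype.ext (tendsto_nhds_unique (hL 1 t) (by simp))
      map_mul' := fun f g => Subtype.ext (tendsto_nhds_unique (hL (f * g) t)
        (by simpa using (hL f t).mul (hL g t)))
      map_zero' := Subtype.ext (tendsto_nhds_unique (hL 0 t) (by simp))
      map_add' := fun f g => Subtype.ext (tendsto_nhds_unique (hL (f + g) t)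
        (by simpa using (hL f t).add (hL g t)))
      commutes' := fun c => Subtype.ext (tendsto_nhds_unique (hL (algebraMap ℂ R c) t) (by
        have : ∀ i, φ i t ((algebraMap ℂ R c : R) : A) = algebraMap ℂ A c := fun i =>
          AlgHomClass.commutes (φ i t) c
        simp only [this]
        exact tendsto_const_nhds))
      map_star' := fun f => Subtype.ext (tendsto_nhds_unique (hL (star f) t)
        (((hL f t).star).congr fun i => (map_star (φ i t) _).symm)) }
  have ha : ∀ f t, (a t f : A) = L f t := fun _ _ => rfl
  have ha0 : ∀ f, a 0 f = f := fun f => Subtype.ext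
    (tendsto_nhds_unique (hL f 0) (by simp [h0]))
  have haadd : ∀ s t f, a (s + t) f = a s (a t f) := by
    intro s t f
    refine Subtype.ext (tendsto_nhds_unique (hL f (s + t)) ?_)
    have h1 : Tendsto (fun i => φ i s (φ i t f - L f t)) atTop (𝓝 0) := by
      refine squeeze_zero_norm (fun i => hφ i s _) ?_
      simpa using ((hL f t).sub_const (L f t)).norm
    have h2 := h1.add (hL (a t f) s)
    rw [zero_add] at h2
    refine h2.congr fun i => ?_
    rw [hadd, map_sub, ha, sub_add_cancel]
  refine ⟨oneParameterGroup a ha0 haadd, fun f T => ?_⟩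
  rw [Metric.tendstoUniformlyOn_iff]
  intro ε hε
  filter_upwards [hle f.2 T (ε / 2) (half_pos hε)] with i hi t ht
  rw [oneParameterGroup_apply, ha, dist_comm, dist_eq_norm]
  refine lt_of_le_of_lt ?_ (half_lt_self hε)
  refine le_of_tendsto ((hL f t).const_sub (φ i t f)).norm ?_
  filter_upwards [eventually_ge_atTop i] with j hj using hi j hj t ht

end Limit

/-! ### Locality of the dynamics -/

/-- Grönwall's inequality for a weighted sum of norms, in both time directions. -/
theorem sum_mul_norm_le_gronwallBound {ι E : Type*} [Fintype ι] [NormedAddCommGroup E]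
    [NormedSpace ℝ E] {a : ι → ℝ} (ha : ∀ i, 0 ≤ a i) {x x' : ℝ → ι → E} {K ε : ℝ}
    (h : ∀ t i, HasDerivAt (fun s => x s i) (x' t i) t) (h0 : ∀ i, x 0 i = 0)
    (hb : ∀ t, ∑ i, a i * ‖x' t i‖ ≤ K * ∑ i, a i * ‖x t i‖ + ε) (t : ℝ) :
    ∑ i, a i * ‖x t i‖ ≤ gronwallBound 0 K ε |t| := by
  have key : ∀ {x x' : ℝ → ι → E}, (∀ t i, HasDerivAt (fun s => x s i) (x' t i) t) →
      (∀ i, x 0 i = 0) → (∀ t, ∑ i, a i * ‖x' t i‖ ≤ K * ∑ i, a i * ‖x t i‖ + ε) →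
      ∀ t, 0 ≤ t → ∑ i, a i * ‖x t i‖ ≤ gronwallBound 0 K ε t := by
    intro x x' h h0 hb t ht
    -- The weighted sum is the `ℓ¹` norm of the rescaled curve.
    let e := (PiLp.continuousLinearEquiv 1 ℝ fun _ : ι => E).symm
    have hnorm : ∀ y : ι → E, ‖e fun i => a i • y i‖ = ∑ i, a i * ‖y i‖ := fun y => by
      rw [PiLp.norm_eq_of_L1]
      exact Finset.sum_congr rfl fun i _ => by
        change ‖a i • y i‖ = _
        rw [norm_smul, Real.norm_of_nonneg (ha i)]
    have hd : ∀ s, HasDerivAt (fun s => e fun i => a i • x s i) (e fun i => a i • x' s i) s :=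
      fun s => e.hasFDerivAt.comp_hasDerivAt s (hasDerivAt_pi.2 fun i => (h s i).const_smul (a i))
    have := norm_le_gronwallBound_of_norm_deriv_right_le (δ := 0) (K := K) (ε := ε) (a := 0) (b := t)
      (fun s _ => (hd s).continuousAt.continuousWithinAt) (fun s _ => (hd s).hasDerivWithinAt)
      (by rw [hnorm]; simp [h0]) (fun s _ => by rw [hnorm, hnorm]; exact hb s) t ⟨ht, le_rfl⟩
    rwa [hnorm, sub_zero] at this
  rcases le_total 0 t with ht | ht
  · rw [abs_of_nonneg ht]
    exact key h h0 hb t ht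
  · have h1 := key (x := fun s => x (-s)) (x' := fun s i => -x' (-s) i)
      (fun s i => by
        simpa [Function.comp_def] using (h (-s) i).scomp s (hasDerivAt_neg s))
      (by simpa using h0) (fun s => by simpa using hb (-s)) (-t) (by linarith)
    rw [abs_of_nonpos ht]
    simpa using h1

namespace IsDecayFunction

variable {Γ : Type*} [MetricSpace Γ] {F : ℝ≥0 → ℝ}

theorem exists_sum_le (hF : IsDecayFunction Γ F) :
    ∃ N, 0 ≤ N ∧ ∀ (y : Γ) (s : Finset Γ), ∑ x ∈ s, F (nndist y x) ≤ N := by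
  obtain ⟨N, hN⟩ := hF.bddAbove
  refine ⟨|N|, abs_nonneg N, fun y s => ?_⟩
  simp only [nndist_comm y]
  exact ((hF.summable y).sum_le_tsum s fun x _ => (hF.pos _).le).trans
    ((hN ⟨y, rfl⟩).trans (le_abs_self N))

theorem exists_sum_mul_le (hF : IsDecayFunction Γ F) :
    ∃ CF, 0 < CF ∧ ∀ (x y : Γ) (s : Finset Γ),
      ∑ z ∈ s, F (nndist x z) * F (nndist z y) ≤ CF * F (nndist x y) := by
  obtain ⟨CF, hCF, h⟩ := hF.convolution
  exact ⟨CF, hCF, fun x y s => ((h x y).1.sum_le_tsum s fun z _ =>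
    (mul_pos (hF.pos _) (hF.pos _)).le).trans (h x y).2⟩

theorem exists_finset_sum_lt (hF : IsDecayFunction Γ F) (k : Γ) {ε : ℝ} (hε : 0 < ε) :
    ∃ s : Finset Γ, ∀ t, Disjoint t s → ∑ l ∈ t, F (nndist k l) < ε := by
  obtain ⟨s, hs⟩ := summable_iff_vanishing_norm.1 (hF.summable k) ε hε
  refine ⟨s, fun t ht => ?_⟩
  simp only [nndist_comm k]
  exact (le_abs_self _).trans_lt (hs t ht)

end IsDecayFunction

namespace OscillatorSystem

open PhaseSpace ResolventAlgebra

variable {Γ : Type*} [MetricSpace Γ] {d : ℕ} {S : OscillatorSystem Γ d} {C : Γ → Γ → ℝ} {CV : ℝ}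
  {F : ℝ≥0 → ℝ}

open Classical in
/-- The dynamics of two nested finite systems differ at a site `k` by an amount that is controlled
by the interaction of `k` with the sites that belong to the larger system only. The differences at
all sites of the smaller system are weighted with `F (d(k, ·))`; by the convolution property of `F`
the weighted sum satisfies a Grönwall inequality. -/
theorem IsAdmissible.exists_norm_sub_le_gronwallBound (hF : IsDecayFunction Γ F)
    (hS : S.IsAdmissible C CV)
    (hΨ : BddAbove (Set.range fun z : Γ × Γ => C z.1 z.2 / F (nndist z.1 z.2))) :
    ∃ K D : ℝ, 0 ≤ K ∧ 0 ≤ D ∧ ∀ (Λ Λ' : Finset Γ), Λ ⊆ Λ' → ∀ k ∈ Λ, ∀ (w : PhaseSpace Γ d) (t : ℝ),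
      ‖(p (hS.localFlow Λ t w) k - p (hS.localFlow Λ' t w) k,
        q (hS.localFlow Λ t w) k - q (hS.localFlow Λ' t w) k)‖ ≤
      gronwallBound 0 K (D * ∑ l ∈ Λ' \ Λ, F (nndist k l)) |t| := by
  obtain ⟨N, hN0, hN⟩ := hF.exists_sum_le
  obtain ⟨CF, hCF, hconv⟩ := hF.exists_sum_mul_le
  obtain ⟨c₀, hc₀⟩ := hΨ
  obtain ⟨am, bm, ham, hm⟩ := hS.mass_bounds
  obtain ⟨aν, bν, haν, hν⟩ := hS.force_bounds
  set c := |c₀|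
  have hC : ∀ k l, C k l ≤ c * F (nndist k l) := fun k l => by
    have h1 : C k l / F (nndist k l) ≤ c := (hc₀ ⟨(k, l), rfl⟩).trans (le_abs_self _)
    rwa [div_le_iff₀ (hF.pos _)] at h1
  have hFnn : ∀ k l : Γ, 0 ≤ F (nndist k l) := fun k l => (hF.pos _).le
  have hCV := hS.CV_nonneg
  -- bounds for the forces and for their variation
  set D₁ : ℝ := d * (c * CV)
  set D₂ : ℝ := d * (d * (c * CV ^ 2))
  have hD₁ : 0 ≤ D₁ := by positivity
  have hD₂ : 0 ≤ D₂ := by positivity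
  have hforce : ∀ k l u, ‖∇ (S.V k l) u‖ ≤ D₁ * F (nndist k l) := fun k l u => by
    refine (hS.norm_gradient_le k l u).trans ?_
    calc d * (C k l * CV) ≤ d * (c * F (nndist k l) * CV) := by gcongr; exact hC k l
      _ = D₁ * F (nndist k l) := by ring
  have hforce' : ∀ k l u v, ‖∇ (S.V k l) u - ∇ (S.V k l) v‖ ≤ D₂ * F (nndist k l) * ‖u - v‖ :=
    fun k l u v => by
      refine (hS.norm_gradient_sub_le k l u v).trans
        (mul_le_mul_of_nonneg_right ?_ (norm_nonneg _))
      calc d * (d * (C k l * CV ^ 2)) ≤ d * (d * (c * F (nndist k l) * CV ^ 2)) := by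
            gcongr; exact hC k l
        _ = D₂ * F (nndist k l) := by ring
  set b : ℝ := |bm| + |bν|
  refine ⟨b + D₂ * N + D₂ * CF, D₁ * CF, by positivity, by positivity, ?_⟩
  intro Λ Λ' hΛ k hk w t
  let δ : ℝ → Λ → EuclideanSpace ℝ (Fin d) × EuclideanSpace ℝ (Fin d) := fun t i =>
    (p (hS.localFlow Λ t w) i - p (hS.localFlow Λ' t w) i,
      q (hS.localFlow Λ t w) i - q (hS.localFlow Λ' t w) i)
  let δ' : ℝ → Λ → EuclideanSpace ℝ (Fin d) × EuclideanSpace ℝ (Fin d) := fun t i =>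
    (-S.gradQ Λ (p (hS.localFlow Λ t w)) (q (hS.localFlow Λ t w)) i -
        -S.gradQ Λ' (p (hS.localFlow Λ' t w)) (q (hS.localFlow Λ' t w)) i,
      S.gradP Λ (p (hS.localFlow Λ t w)) (q (hS.localFlow Λ t w)) i -
        S.gradP Λ' (p (hS.localFlow Λ' t w)) (q (hS.localFlow Λ' t w)) i)
  have hδ : ∀ t i, HasDerivAt (fun s => δ s i) (δ' t i) t := fun t i => by
    have h1 := hS.isTrajectory_localFlow (Λ := Λ) w t i
    have h2 := hS.isTrajectory_localFlow (Λ := Λ') w t i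
    exact (h1.2.sub h2.2).prodMk (h1.1.sub h2.1)
  have hδ0 : ∀ i, δ 0 i = 0 := fun i => by simp [δ, hS.localFlow_zero]
  have hbound : ∀ t (i : Λ), ‖δ' t i‖ ≤ (b + D₂ * N) * ‖δ t i‖ +
      D₂ * ∑ l : Λ, F (nndist (i : Γ) l) * ‖δ t l‖ +
      D₁ * ∑ l ∈ Λ' \ Λ, F (nndist (i : Γ) l) := by
    intro t i
    have hq : ∀ l : Λ, ‖q (hS.localFlow Λ t w) l - q (hS.localFlow Λ' t w) l‖ ≤ ‖δ t l‖ :=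
      fun l => norm_snd_le (δ t l)
    have hp : ‖p (hS.localFlow Λ t w) i - p (hS.localFlow Λ' t w) i‖ ≤ ‖δ t i‖ :=
      norm_fst_le (δ t i)
    have hn1 : 0 ≤ D₂ * ∑ l : Λ, F (nndist (i : Γ) l) * ‖δ t l‖ :=
      mul_nonneg hD₂ (Finset.sum_nonneg fun l _ => mul_nonneg (hFnn _ _) (norm_nonneg _))
    have hn2 : 0 ≤ D₁ * ∑ l ∈ Λ' \ Λ, F (nndist (i : Γ) l) :=
      mul_nonneg hD₁ (Finset.sum_nonneg fun l _ => hFnn _ _)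
    have hn3 : 0 ≤ D₂ * N * ‖δ t i‖ := by positivity
    refine norm_prod_le_iff.2 ⟨?_, ?_⟩
    · change ‖-S.gradQ Λ _ _ _ - -S.gradQ Λ' _ _ _‖ ≤ _
      rw [hS.gradQ_of_mem _ _ i.2, hS.gradQ_of_mem _ _ (hΛ i.2), ← Finset.sum_sdiff hΛ]
      have e : ∀ a a' s s' r : EuclideanSpace ℝ (Fin d),
          -(S.ν i • a + s) - -(S.ν i • a' + (r + s')) = -(S.ν i • (a - a')) - (s - s') + r := by
        intros; module
      rw [e, ← Finset.sum_sub_distrib]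
      have h1 : ‖-(S.ν i • (q (hS.localFlow Λ t w) i - q (hS.localFlow Λ' t w) i))‖ ≤
          b * ‖δ t i‖ := by
        rw [norm_neg, norm_smul]
        refine mul_le_mul ?_ (hq i) (norm_nonneg _) (by positivity)
        rw [Real.norm_of_nonneg (hS.ν_pos i).le]
        have := (hν i).2.trans (le_abs_self bν)
        have := abs_nonneg bm
        simp only [b]
        linarith
      have h2 : ‖∑ l ∈ Λ, (∇ (S.V i l) (q (hS.localFlow Λ t w) i - q (hS.localFlow Λ t w) l) -
          ∇ (S.V i l) (q (hS.localFlow Λ' t w) i - q (hS.localFlow Λ' t w) l))‖ ≤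
          D₂ * N * ‖δ t i‖ + D₂ * ∑ l : Λ, F (nndist (i : Γ) l) * ‖δ t l‖ := by
        rw [← Finset.sum_coe_sort]
        calc _ ≤ ∑ l : Λ, D₂ * F (nndist (i : Γ) l) * (‖δ t i‖ + ‖δ t l‖) := by
              refine (norm_sum_le _ _).trans (Finset.sum_le_sum fun l _ => ?_)
              refine (hforce' _ _ _ _).trans ?_
              have := hFnn i l
              gcongr
              rw [sub_sub_sub_comm]
              exact (norm_sub_le _ _).trans (add_le_add (hq i) (hq l))
          _ = D₂ * (∑ l : Λ, F (nndist (i : Γ) l)) * ‖δ t i‖ +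
              D₂ * ∑ l : Λ, F (nndist (i : Γ) l) * ‖δ t l‖ := by
              simp only [Finset.mul_sum, Finset.sum_mul, ← Finset.sum_add_distrib]
              exact Finset.sum_congr rfl fun l _ => by ring
          _ ≤ _ := by
              gcongr
              rw [Finset.sum_coe_sort Λ fun l => F (nndist (i : Γ) l)]
              exact hN i Λ
      have h3 : ‖∑ l ∈ Λ' \ Λ,
          ∇ (S.V i l) (q (hS.localFlow Λ' t w) i - q (hS.localFlow Λ' t w) l)‖ ≤
          D₁ * ∑ l ∈ Λ' \ Λ, F (nndist (i : Γ) l) := by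
        rw [Finset.mul_sum]
        exact (norm_sum_le _ _).trans (Finset.sum_le_sum fun l _ => hforce _ _ _)
      refine (norm_add_le _ _).trans ?_
      have h4 := norm_sub_le (-(S.ν i • (q (hS.localFlow Λ t w) i - q (hS.localFlow Λ' t w) i)))
        (∑ l ∈ Λ, (∇ (S.V i l) (q (hS.localFlow Λ t w) i - q (hS.localFlow Λ t w) l) -
          ∇ (S.V i l) (q (hS.localFlow Λ' t w) i - q (hS.localFlow Λ' t w) l)))
      linarith
    · change ‖S.gradP Λ _ _ _ - S.gradP Λ' _ _ _‖ ≤ _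
      rw [gradP_of_mem _ _ i.2, gradP_of_mem _ _ (hΛ i.2), ← smul_sub, norm_smul]
      have h1 : ‖(S.m i)⁻¹‖ * ‖p (hS.localFlow Λ t w) i - p (hS.localFlow Λ' t w) i‖ ≤
          b * ‖δ t i‖ := by
        refine mul_le_mul ?_ hp (norm_nonneg _) (by positivity)
        rw [Real.norm_of_nonneg (inv_nonneg.2 (hS.m_pos i).le)]
        have h2 := (hm i).2.trans (le_abs_self bm)
        rw [one_div] at h2
        have := abs_nonneg bν
        simp only [b]
        linarith
      linarith
  have hsum : ∀ t, ∑ i : Λ, F (nndist k i) * ‖δ' t i‖ ≤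
      (b + D₂ * N + D₂ * CF) * ∑ i : Λ, F (nndist k i) * ‖δ t i‖ +
        D₁ * CF * ∑ l ∈ Λ' \ Λ, F (nndist k l) := by
    intro t
    have hconv' : ∀ l, ∑ i : Λ, F (nndist k i) * F (nndist (i : Γ) l) ≤ CF * F (nndist k l) :=
      fun l => by
        rw [Finset.sum_coe_sort Λ fun i => F (nndist k i) * F (nndist i l)]
        exact hconv k l Λ
    calc _ ≤ ∑ i : Λ, F (nndist k i) * ((b + D₂ * N) * ‖δ t i‖ +
          D₂ * ∑ l : Λ, F (nndist (i : Γ) l) * ‖δ t l‖ +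
          D₁ * ∑ l ∈ Λ' \ Λ, F (nndist (i : Γ) l)) :=
          Finset.sum_le_sum fun i _ => mul_le_mul_of_nonneg_left (hbound t i) (hFnn _ _)
      _ = (b + D₂ * N) * ∑ i : Λ, F (nndist k i) * ‖δ t i‖ +
          D₂ * ∑ l : Λ, (∑ i : Λ, F (nndist k i) * F (nndist (i : Γ) l)) * ‖δ t l‖ +
          D₁ * ∑ l ∈ Λ' \ Λ, ∑ i : Λ, F (nndist k i) * F (nndist (i : Γ) l) := by
          simp only [mul_add, Finset.sum_add_distrib, Finset.mul_sum, Finset.sum_mul]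
          congr 1
          · congr 1
            · exact Finset.sum_congr rfl fun i _ => by ring
            · rw [Finset.sum_comm]
              exact Finset.sum_congr rfl fun i _ => Finset.sum_congr rfl fun l _ => by ring
          · rw [Finset.sum_comm]
            exact Finset.sum_congr rfl fun i _ => Finset.sum_congr rfl fun l _ => by ring
      _ ≤ (b + D₂ * N) * ∑ i : Λ, F (nndist k i) * ‖δ t i‖ +
          D₂ * ∑ l : Λ, CF * F (nndist k l) * ‖δ t l‖ +
          D₁ * ∑ l ∈ Λ' \ Λ, CF * F (nndist k l) := by
          gcongr with l _ l _
          · exact hconv' l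
          · exact hconv' l
      _ = _ := by
          simp only [mul_assoc, ← Finset.mul_sum]
          ring
  have hmain := sum_mul_norm_le_gronwallBound (a := fun i : Λ => F (nndist k i))
    (fun i => hFnn _ _) hδ hδ0 hsum t
  have hone := Finset.single_le_sum (f := fun i : Λ => F (nndist k i) * ‖δ t i‖)
    (fun i _ => mul_nonneg (hFnn _ _) (norm_nonneg _)) (Finset.mem_univ ⟨k, hk⟩)
  simp only [nndist_self, hF.map_zero, one_mul] at hone
  exact hone.trans hmain

/-- At every site, the finite-volume dynamics converge, uniformly in the initial point and on compact
time intervals. -/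
theorem IsAdmissible.eventually_norm_sub_le (hF : IsDecayFunction Γ F) (hS : S.IsAdmissible C CV)
    (hΨ : BddAbove (Set.range fun z : Γ × Γ => C z.1 z.2 / F (nndist z.1 z.2)))
    (k : Γ) (T : ℝ) {η : ℝ} (hη : 0 < η) :
    ∀ᶠ Λ : Finset Γ in atTop, ∀ Λ' ≥ Λ, ∀ t ∈ Set.Icc (-T) T, ∀ w : PhaseSpace Γ d,
      ‖(p (hS.localFlow Λ t w) k - p (hS.localFlow Λ' t w) k,
        q (hS.localFlow Λ t w) k - q (hS.localFlow Λ' t w) k)‖ ≤ η := by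
  classical
  obtain ⟨K, D, hK, hD, h⟩ := hS.exists_norm_sub_le_gronwallBound hF hΨ
  have hlim : Tendsto (fun ε => gronwallBound 0 K (D * ε) T) (𝓝 0) (𝓝 0) := by
    have := ((gronwallBound_continuous_ε 0 K T).comp (continuous_const_mul D)).tendsto 0
    simpa [Function.comp_def, gronwallBound_ε0_δ0] using this
  obtain ⟨ε, hε, hεη⟩ := Metric.eventually_nhds_iff.1 (hlim.eventually (ge_mem_nhds hη))
  obtain ⟨s, hs⟩ := hF.exists_finset_sum_lt k hε
  filter_upwards [eventually_ge_atTop (insert k s)] with Λ hΛ Λ' hΛ' t ht w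
  have hsum0 : 0 ≤ ∑ l ∈ Λ' \ Λ, F (nndist k l) := Finset.sum_nonneg fun l _ => (hF.pos _).le
  have hsum : ∑ l ∈ Λ' \ Λ, F (nndist k l) < ε :=
    hs _ (Finset.sdiff_disjoint.mono_right ((Finset.subset_insert k s).trans hΛ))
  refine (h Λ Λ' hΛ' k (hΛ (Finset.mem_insert_self k s)) w t).trans ?_
  refine (gronwallBound_mono le_rfl (mul_nonneg hD hsum0) hK (abs_le.2 ht)).trans ?_
  exact hεη (by rwa [Real.dist_eq, sub_zero, abs_of_nonneg hsum0])

omit [MetricSpace Γ] in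
theorem IsAdmissible.norm_evolution_le (hS : S.IsAdmissible C CV) (Λ : Finset Γ) (t : ℝ)
    (f : PhaseSpace Γ d →ᵇ ℂ) : ‖hS.evolution Λ t f‖ ≤ ‖f‖ := norm_pullback_le _ f

/-- The finite-volume dynamics are Cauchy on the resolvent algebra. -/
theorem IsAdmissible.commResolventAlgebra_le_cauchySubalgebra (hF : IsDecayFunction Γ F)
    (hS : S.IsAdmissible C CV)
    (hΨ : BddAbove (Set.range fun z : Γ × Γ => C z.1 z.2 / F (nndist z.1 z.2))) :
    commResolventAlgebra (PhaseSpace Γ d) ≤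
      cauchySubalgebra (fun (Λ : Finset Γ) t => hS.evolution Λ t) hS.norm_evolution_le := by
  refine StarSubalgebra.closure_adjoin_le ?_ (isClosed_cauchySubalgebra _)
  rintro _ ⟨x, -, r, hr, rfl⟩ T ε hε
  -- `x` is supported in a finite set of sites
  obtain ⟨X, hX⟩ : ∃ X : Finset Γ, extendZero X (restrictTo X x) = x := by
    have hx : {k : Γ | (x : lp (fun _ : Γ => SitePhaseSpace d) 2) k ≠ 0}.Finite := x.2
    have hx0 : ∀ k ∉ hx.toFinset, (x : lp (fun _ : Γ => SitePhaseSpace d) 2) k = 0 :=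
      fun k hk => not_not.1 (mt hx.mem_toFinset.2 hk)
    refine ⟨hx.toFinset, ext_pq (fun k => ?_) fun k => ?_⟩
    · by_cases hk : k ∈ hx.toFinset
      · exact p_extendZero _ ⟨k, hk⟩
      · rw [p_extendZero_of_notMem _ hk, p, hx0 k hk]
        rfl
    · by_cases hk : k ∈ hx.toFinset
      · exact q_extendZero _ ⟨k, hk⟩
      · rw [q_extendZero_of_notMem _ hk, q, hx0 k hk]
        rfl
  set M : ℝ := ∑ k : X, (‖p x k‖ + ‖q x k‖)
  have hM : 0 ≤ M := Finset.sum_nonneg fun k _ => by positivity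
  have hr2 : 0 < |r| ^ 2 := by have := abs_pos.2 hr; positivity
  have hη : 0 < ε * |r| ^ 2 / (M + 1) := by positivity
  have hev := (eventually_all_finset X).2 fun k (_ : k ∈ X) =>
    hS.eventually_norm_sub_le hF hΨ k T hη
  filter_upwards [hev] with Λ hΛ Λ' hΛ' t ht
  refine (norm_le hε.le).2 fun w => ?_
  change ‖1 / (Complex.I * (r : ℂ) - ((inner ℝ x (hS.localFlow Λ t w) : ℝ) : ℂ)) -
    1 / (Complex.I * (r : ℂ) - ((inner ℝ x (hS.localFlow Λ' t w) : ℝ) : ℂ))‖ ≤ ε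
  refine (norm_resolvent_sub_le hr _ _).trans ?_
  rw [div_le_iff₀ hr2, ← inner_sub_right, ← hX, inner_extendZero, inner_local]
  calc _ ≤ ∑ k : X, (‖p x k‖ + ‖q x k‖) * (ε * |r| ^ 2 / (M + 1)) := by
        refine (Finset.abs_sum_le_sum_abs _ _).trans (Finset.sum_le_sum fun k _ => ?_)
        have hk := norm_prod_le_iff.1 (hΛ k k.2 Λ' hΛ' t ht w)
        rw [add_mul]
        refine (abs_add_le _ _).trans (add_le_add ?_ ?_)
        · exact (abs_real_inner_le_norm _ _).trans
            (mul_le_mul_of_nonneg_left hk.1 (norm_nonneg _))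
        · exact (abs_real_inner_le_norm _ _).trans
            (mul_le_mul_of_nonneg_left hk.2 (norm_nonneg _))
    _ = M * (ε * |r| ^ 2 / (M + 1)) := by rw [← Finset.sum_mul]
    _ ≤ (M + 1) * (ε * |r| ^ 2 / (M + 1)) := by gcongr; linarith
    _ = ε * |r| ^ 2 := by field_simp

end OscillatorSystem

/-! ### The infinite-volume dynamics -/

/-- Existence of the infinite-volume dynamics. -/
theorem theorem4p1 {Γ : Type*} [MetricSpace Γ] [Countable Γ] {d : ℕ}
    (F : ℝ≥0 → ℝ) (hF : IsDecayFunction Γ F)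
    (S : OscillatorSystem Γ d) (C : Γ → Γ → ℝ) (CV : ℝ) (hS : S.IsAdmissible C CV)
    (hΨ : BddAbove (Set.range fun z : Γ × Γ => C z.1 z.2 / F (nndist z.1 z.2))) :
    -- the local flows are well defined
    (∀ (Λ : Finset Γ) (w : PhaseSpace Γ d),
      ∃! γ : ℝ → PhaseSpace Γ d, γ 0 = w ∧ S.IsTrajectory Λ γ) ∧
    -- the pull-backs by the local flows are one-parameter groups of automorphisms
    ∃ αloc : Finset Γ → Multiplicative ℝ →*
        (commResolventAlgebra (PhaseSpace Γ d) ≃⋆ₐ[ℂ] commResolventAlgebra (PhaseSpace Γ d)),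
      (∀ (Λ : Finset Γ) (t : ℝ) (f : commResolventAlgebra (PhaseSpace Γ d)) (w : PhaseSpace Γ d),
        (αloc Λ (Multiplicative.ofAdd t) f : PhaseSpace Γ d →ᵇ ℂ) w
          = (f : PhaseSpace Γ d →ᵇ ℂ) (S.flow Λ t w)) ∧
      -- which restrict to the algebra of the finite system
      (∀ (Λ : Finset Γ) (t : ℝ) (f : commResolventAlgebra (PhaseSpace Γ d)),
        (f : PhaseSpace Γ d →ᵇ ℂ) ∈ ResolventAlgebra.algebraOn (PhaseSpace.localSpace Λ) →
        (αloc Λ (Multiplicative.ofAdd t) f : PhaseSpace Γ d →ᵇ ℂ)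
          ∈ ResolventAlgebra.algebraOn (PhaseSpace.localSpace Λ)) ∧
      -- and which converge, uniformly on compact time intervals, to such a group
      ∃ α : Multiplicative ℝ →*
          (commResolventAlgebra (PhaseSpace Γ d) ≃⋆ₐ[ℂ] commResolventAlgebra (PhaseSpace Γ d)),
        ∀ (f : commResolventAlgebra (PhaseSpace Γ d)) (T : ℝ),
          TendstoUniformlyOn
            (fun (Λ : Finset Γ) (t : ℝ) => αloc Λ (Multiplicative.ofAdd t) f)
            (fun t : ℝ => α (Multiplicative.ofAdd t) f)
            atTop (Set.Icc (-T) T) := by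
  have hev0 : ∀ (Λ : Finset Γ) (f : PhaseSpace Γ d →ᵇ ℂ), hS.evolution Λ 0 f = f := fun Λ f => by
    ext w
    rw [hS.evolution_apply, hS.localFlow_zero]
  have hevadd : ∀ (Λ : Finset Γ) (s t : ℝ) (f : PhaseSpace Γ d →ᵇ ℂ),
      hS.evolution Λ (s + t) f = hS.evolution Λ s (hS.evolution Λ t f) := fun Λ s t f => by
    ext w
    rw [hS.evolution_apply, hS.evolution_apply, hS.evolution_apply, add_comm, hS.localFlow_add]
  have hinv : ∀ (Λ : Finset Γ) (t : ℝ), ∀ f ∈ commResolventAlgebra (PhaseSpace Γ d),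
      hS.evolution Λ t f ∈ commResolventAlgebra (PhaseSpace Γ d) := fun Λ t f hf =>
    hS.evolution_mem le_top t hf
  let a : Finset Γ → ℝ → commResolventAlgebra (PhaseSpace Γ d) →⋆ₐ[ℂ]
      commResolventAlgebra (PhaseSpace Γ d) := fun Λ t =>
    StarAlgHom.codRestrict ((hS.evolution Λ t).comp (StarSubalgebra.subtype _)) _
      fun f => hinv Λ t f f.2
  let αloc : Finset Γ → Multiplicative ℝ →*
      (commResolventAlgebra (PhaseSpace Γ d) ≃⋆ₐ[ℂ] commResolventAlgebra (PhaseSpace Γ d)) :=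
    fun Λ => oneParameterGroup (a Λ) (fun f => Subtype.ext (hev0 Λ f))
      fun s t f => Subtype.ext (hevadd Λ s t f)
  have hαloc : ∀ (Λ : Finset Γ) (t : ℝ) (f : commResolventAlgebra (PhaseSpace Γ d)),
      (αloc Λ (Multiplicative.ofAdd t) f : PhaseSpace Γ d →ᵇ ℂ) = hS.evolution Λ t f :=
    fun Λ t f => rfl
  refine ⟨hS.existsUnique_trajectory, αloc, fun Λ t f w => ?_, fun Λ t f hf => ?_, ?_⟩
  · rw [hαloc, hS.evolution_apply, hS.flow_eq]
  · rw [hαloc]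
    exact hS.evolution_mem le_rfl t hf
  · have hclosed : IsClosed (commResolventAlgebra (PhaseSpace Γ d) : Set (PhaseSpace Γ d →ᵇ ℂ)) :=
      StarSubalgebra.isClosed_topologicalClosure _
    have hcauchy := hS.commResolventAlgebra_le_cauchySubalgebra hF hΨ
    have hlimit := exists_limit_oneParameterGroup hclosed hS.norm_evolution_le hinv hev0 hevadd
      hcauchy
    obtain ⟨α, hα⟩ := hlimit
    refine ⟨α, fun f T => ?_⟩
    rw [Metric.tendstoUniformlyOn_iff]
    intro ε hε
    filter_upwards [Metric.tendstoUniformlyOn_iff.1 (hα f T) ε hε] with Λ hΛ t ht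
    rw [Subtype.dist_eq, hαloc]
    exact hΛ t ht
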